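/- Let $n,N\ge 0$ be integers, $a<b$, $\beta=\mathrm{diag}(\beta_1,\dots,\beta_n)$ a real diagonal matrix and $\gamma=\gamma^\top\in\mathbb{R}^{n\times n}$. Put $w_0(x)=\frac1{\sqrt{b-a}}$, $w_{2j-1}(x)=\sqrt{\tfrac2{b-a}}\sin\bigl(2\pi j\tfrac{x-a}{b-a}\bigr)$, $w_{2j}(x)=\sqrt{\tfrac2{b-a}}\cos\bigl(2\pi j\tfrac{x-a}{b-a}\bigr)$ for $j\ge1$, $\boldsymbol w=(w_0,\dots,w_{2N})^\top$, $d_j=\frac{2\pi}{b-a}\lceil j/2\rceil$, $D=\mathrm{diag}(d_0,\dots,d_{2N})$, and $$\beta_2=\beta\otimes I_2,\quad \gamma_2=\gamma\otimes I_2,\quad J=I_n\otimes\begin{pmatrix}0&1\\-1&0\end{pmatrix},\quad Q=I_n\otimes\begin{pmatrix}1&1\\1&1\end{pmatrix}.$$ Consider the Fourier--Galerkin semi-discretization of the Manakov system, i.e. the ODE for $\boldsymbol y=(y_0,\dots,y_{2N})\in\mathbb{R}^{2n\times(2N+1)}$ (products $\circ$ and squares of vectors being componentwise) $$\dot{\boldsymbol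 y}=f(\boldsymbol y):=J\Bigl[\beta_2\boldsymbol yD^2-\int_a^b\bigl[\gamma_2Q(\boldsymbol y\boldsymbol w(x))^2\bigr]\circ(\boldsymbol y\boldsymbol w(x))\,\boldsymbol w(x)^\top dx\Bigr],\qquad \boldsymbol y(0)=\boldsymbol y^0,$$ with Hamiltonian $$H(\boldsymbol y)=\frac12\sum_{j=0}^{2N}d_j^2\,y_j^\top\beta_2y_j-\frac18\int_a^b\bigl[Q(\boldsymbol y\boldsymbol w(x))^2\bigr]^\top\gamma_2\bigl[Q(\boldsymbol y\boldsymbol w(x))^2\bigr]dx .$$ For $k\ge s\ge1$, let $c_1<\dots<c_k$ and $b_1,\dots,b_k$ be the abscissae and weights of the $k$-point Gauss--Legendre formula on $[0,1]$, and let $P_0,P_1,\dots$ be the Legendre polynomials shifted to $[0,1]$ and normalized in $L^2(0,1)$. HBVM$(k,s)$ is the $k$-stage Runge--Kutta method with abscissae $c_i$, weights $b_i$ and coefficients $$a_{il}=b_l\sum_{j=0}^{s-1}P_j(c_l)\int_0^{c_i}P_j(x)\,dx .$$ Then, for every $s\ge1$, HBVM$(2s,s)$ applied to this problem has the following properties.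 1. (Energy conservation) For every stepsize $h\in\mathbb R$, every $\boldsymbol y^0$ and every solution $Y_1,\dots,Y_{2s}$ of the stage equations $Y_i=\boldsymbol y^0+h\sum_l a_{il}f(Y_l)$, the new approximation $\boldsymbol y^1=\boldsymbol y^0+h\sum_i b_if(Y_i)$ satisfies $H(\boldsymbol y^1)=H(\boldsymbol y^0)$. 2. (Order $2s$: local error) For all $R,\rho>0$ there are $h_0>0$ and $C$ such that, for all $\|\boldsymbol y^0\|\le R$ and $0<h\le h_0$, the stage equations have exactly one solution with $\|Y_i-\boldsymbol y^0\|\le\rho$ for all $i$, and the resulting $\boldsymbol y^1$ satisfies $\|\boldsymbol y^1-\boldsymbol y(h)\|\le C\,h^{2s+1}$ for every exact solution $\boldsymbol y$ on $[0,h]$ with $\boldsymbol y(0)=\boldsymbol y^0$. 3. (Order $2s$: global error) For all $T,\rho>0$ and every exact solution $\boldsymbol y$ on $[0,T]$ there are $h_0>0$ and $C$ such that, for all $0<h\le h_0$ and all integers $m\ge 0$ with $mh\le T$, numerical solutions $\boldsymbol z_0=\boldsymbol y(0),\boldsymbol z_1,\dots,\boldsymbol z_m$ with stepsize $h$ (all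 stages of the $i$-th step being within distance $\rho$ of $\boldsymbol z_i$) exist, and every such numerical solution satisfies $\|\boldsymbol z_i-\boldsymbol y(ih)\|\le C\,h^{2s}$ for $i\le m$. Here $\|\cdot\|$ is the maximum norm of the entries. -/

import Mathlib

attribute [local instance] Matrix.normedAddCommGroup Matrix.normedSpace

/-! ### Runge–Kutta methods for autonomous equations `y' = f y` -/

namespace RungeKutta

/-- A Butcher tableau with `k` stages: coefficient matrix, weights, abscissae. -/
structure Tableau (k : ℕ) where
  A : Matrix (Fin k) (Fin k) ℝ
  b : Fin k → ℝ
  c : Fin k → ℝ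

variable {E : Type*} [NormedAddCommGroup E] [NormedSpace ℝ E] {k : ℕ}

/-- `Y` solves the stage equations `Y_i = y₀ + h ∑ⱼ A_ij f(Y_j)`. -/
def IsStages (M : Tableau k) (f : E → E) (h : ℝ) (y₀ : E) (Y : Fin k → E) : Prop :=
  ∀ i, Y i = y₀ + h • ∑ j, M.A i j • f (Y j)

/-- The new approximation `y₁ = y₀ + h ∑ᵢ b_i f(Y_i)`. -/
def update (M : Tableau k) (f : E → E) (h : ℝ) (y₀ : E) (Y : Fin k → E) : E :=
  y₀ + h • ∑ i, M.b i • f (Y i)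

/-- The stage vector `Y` solves the stage equations and all the stages lie within distance `ρ`
of `y₀`. (The method being implicit and `f` nonlinear, there may be other, spurious solutions of
the stage equations, far away from `y₀`.) -/
def IsStagesNear (M : Tableau k) (f : E → E) (ρ h : ℝ) (y₀ : E) (Y : Fin k → E) : Prop :=
  IsStages M f h y₀ Y ∧ ∀ i, ‖Y i - y₀‖ ≤ ρ

/-- `y` is a solution of `y' = f y` on `[0, T]`. -/
def IsSolutionOn (f : E → E) (T : ℝ) (y : ℝ → E) : Prop :=
  ∀ t ∈ Set.Icc 0 T, HasDerivWithinAt y (f (y t)) (Set.Icc 0 T) t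

/-- `z₀, …, z_m` is a numerical solution with constant stepsize `h`. -/
def IsTrajectory (M : Tableau k) (f : E → E) (ρ h : ℝ) (m : ℕ) (z : ℕ → E) : Prop :=
  ∀ i < m, ∃ Y, IsStagesNear M f ρ h (z i) Y ∧ z (i + 1) = update M f h (z i) Y

/-- The local error is `O(h ^ (p + 1))`, uniformly for initial values in bounded sets; for small
stepsizes the numerical approximation is well defined. -/
def HasLocalOrder (M : Tableau k) (f : E → E) (p : ℕ) : Prop :=
  ∀ R ρ : ℝ, 0 < R → 0 < ρ → ∃ h₀ > 0, ∃ C : ℝ, ∀ y₀ : E, ‖y₀‖ ≤ R → ∀ h ∈ Set.Ioc 0 h₀,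
    (∃! Y, IsStagesNear M f ρ h y₀ Y) ∧
    ∀ Y, IsStagesNear M f ρ h y₀ Y → ∀ y : ℝ → E, IsSolutionOn f h y → y 0 = y₀ →
      ‖update M f h y₀ Y - y h‖ ≤ C * h ^ (p + 1)

/-- The global error on every interval `[0, T]` on which the exact solution `y` exists is
`O(h ^ p)`; for small stepsizes the numerical solution exists up to time `T`. -/
def HasGlobalOrder (M : Tableau k) (f : E → E) (p : ℕ) : Prop :=
  ∀ T ρ : ℝ, 0 < T → 0 < ρ → ∀ y : ℝ → E, IsSolutionOn f T y →
    ∃ h₀ > 0, ∃ C : ℝ, ∀ h ∈ Set.Ioc 0 h₀, ∀ m : ℕ, m * h ≤ T →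
      (∃ z, z 0 = y 0 ∧ IsTrajectory M f ρ h m z) ∧
      ∀ z, z 0 = y 0 → IsTrajectory M f ρ h m z → ∀ i ≤ m, ‖z i - y (i * h)‖ ≤ C * h ^ p

/-- The method conserves `H` exactly: in each step, from any `y₀`, with any stepsize and any
solution of the stage equations. -/
def Conserves (M : Tableau k) (f : E → E) (H : E → ℝ) : Prop :=
  ∀ (h : ℝ) (y₀ : E) (Y : Fin k → E), IsStages M f h y₀ Y → H (update M f h y₀ Y) = H y₀

end RungeKutta

/-! ### Hamiltonian Boundary Value Methods -/

namespace HBVM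

/-- The Legendre polynomials shifted to `[0, 1]`, orthonormal in `L²(0,1)`, with positive leading
coefficient. (Mathlib's `shiftedLegendre j` takes the values `1` at `0` and `(-1) ^ j` at `1`.) -/
noncomputable def legendre (j : ℕ) : Polynomial ℝ :=
  Polynomial.C ((-1) ^ j * √(2 * j + 1)) *
    (Polynomial.shiftedLegendre j).map (Int.castRingHom ℝ)

/-- The Gauss–Legendre abscissae on `[0, 1]`: the (`k` simple, real) roots of the `k`-th shifted
Legendre polynomial, in increasing order. -/
noncomputable def gaussNode (k : ℕ) (i : Fin k) : ℝ :=
  ((legendre k).roots.sort (· ≤ ·)).getD i 0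

/-- The Gauss–Legendre weights: integrals of the Lagrange polynomials at the abscissae. -/
noncomputable def gaussWeight (k : ℕ) (i : Fin k) : ℝ :=
  ∫ x in (0 : ℝ)..1, (Lagrange.basis Finset.univ (gaussNode k) i).eval x

/-- `𝒫_s`, with entries `P_j(c_i)`, `j = 0, …, s - 1`. -/
noncomputable def matP (k s : ℕ) : Matrix (Fin k) (Fin s) ℝ :=
  Matrix.of fun i j => (legendre j).eval (gaussNode k i)

/-- `ℐ_s`, with entries `∫₀^{c_i} P_j(x) dx`, `j = 0, …, s - 1`. -/
noncomputable def matI (k s : ℕ) : Matrix (Fin k) (Fin s) ℝ :=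
  Matrix.of fun i j => ∫ x in (0 : ℝ)..gaussNode k i, (legendre j).eval x

/-- The `k`-stage Runge–Kutta method HBVM(k,s), with coefficient matrix `ℐ_s 𝒫_sᵀ Ω`. -/
noncomputable def tableau (k s : ℕ) : RungeKutta.Tableau k where
  A := matI k s * (matP k s).transpose * Matrix.diagonal (gaussWeight k)
  b := gaussWeight k
  c := gaussNode k

end HBVM

/-! ### The Fourier–Galerkin semi-discretization of the Manakov system -/

namespace Manakov

open scoped Matrix Kronecker

/-- The orthonormal trigonometric basis of `L²(a,b)`: `w₀` constant, `w_{2m-1}` the `m`-th sine and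
`w_{2m}` the `m`-th cosine. For `j = 2m - 1` and `j = 2m` one has `m = (j + 1) / 2` in `ℕ`. -/
noncomputable def basisFun (a b : ℝ) (j : ℕ) (x : ℝ) : ℝ :=
  if j = 0 then 1 / √(b - a)
  else if Odd j then
    √(2 / (b - a)) * Real.sin (2 * Real.pi * ((j + 1) / 2 : ℕ) * ((x - a) / (b - a)))
  else
    √(2 / (b - a)) * Real.cos (2 * Real.pi * ((j + 1) / 2 : ℕ) * ((x - a) / (b - a)))

/-- `w(x) = (w₀(x), …, w_{2N}(x))ᵀ`. -/
noncomputable def basisVec (a b : ℝ) (N : ℕ) (x : ℝ) : Fin (2 * N + 1) → ℝ :=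
  fun j => basisFun a b j x

/-- `d_j = (2π / (b - a)) ⌈j / 2⌉`. -/
noncomputable def freq (a b : ℝ) (j : ℕ) : ℝ :=
  2 * Real.pi / (b - a) * ((j + 1) / 2 : ℕ)

/-- `D = diag(d₀, …, d_{2N})`. -/
noncomputable def matD (a b : ℝ) (N : ℕ) : Matrix (Fin (2 * N + 1)) (Fin (2 * N + 1)) ℝ :=
  Matrix.diagonal fun j => freq a b j

/-- Real `2n × (2N+1)` matrices. The row index `(i, 0)` belongs to `q_i` (the real part of the
`i`-th field) and `(i, 1)` to `p_i` (the imaginary part). -/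
abbrev State (n N : ℕ) : Type := Matrix (Fin n × Fin 2) (Fin (2 * N + 1)) ℝ

/-- `J = I_n ⊗ J₂`. -/
def matJ (n : ℕ) : Matrix (Fin n × Fin 2) (Fin n × Fin 2) ℝ :=
  (1 : Matrix (Fin n) (Fin n) ℝ) ⊗ₖ !![0, 1; -1, 0]

/-- `Q = I_n ⊗ (1 1; 1 1)`. -/
def matQ (n : ℕ) : Matrix (Fin n × Fin 2) (Fin n × Fin 2) ℝ :=
  (1 : Matrix (Fin n) (Fin n) ℝ) ⊗ₖ !![1, 1; 1, 1]

/-- `β₂ = β ⊗ I₂`, with `β = diag(β₁, …, β_n)`. -/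
def beta2 {n : ℕ} (β : Fin n → ℝ) : Matrix (Fin n × Fin 2) (Fin n × Fin 2) ℝ :=
  Matrix.diagonal β ⊗ₖ (1 : Matrix (Fin 2) (Fin 2) ℝ)

/-- `γ₂ = γ ⊗ I₂`. -/
def gamma2 {n : ℕ} (γ : Matrix (Fin n) (Fin n) ℝ) : Matrix (Fin n × Fin 2) (Fin n × Fin 2) ℝ :=
  γ ⊗ₖ (1 : Matrix (Fin 2) (Fin 2) ℝ)

/-- The right-hand side
`J [β₂ y D² - ∫_a^b [γ₂ Q (y w(x))²] ∘ (y w(x)) w(x)ᵀ dx]` of the semi-discrete system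
(products and squares of vectors are componentwise, the integral is entrywise). -/
noncomputable def field {n : ℕ} (a b : ℝ) (N : ℕ) (β : Fin n → ℝ) (γ : Matrix (Fin n) (Fin n) ℝ)
    (y : State n N) : State n N :=
  matJ n * (beta2 β * y * matD a b N ^ 2 -
    Matrix.of fun i j => ∫ x in a..b,
      Matrix.vecMulVec
        (((gamma2 γ * matQ n) *ᵥ (y *ᵥ basisVec a b N x) ^ 2) * (y *ᵥ basisVec a b N x))
        (basisVec a b N x) i j)

/-- The Hamiltonian
`½ ∑ⱼ d_j² y_jᵀ β₂ y_j - ⅛ ∫_a^b [Q (y w(x))²]ᵀ γ₂ [Q (y w(x))²] dx`, `y_j` the columns of `y`. -/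
noncomputable def hamiltonian {n : ℕ} (a b : ℝ) (N : ℕ) (β : Fin n → ℝ)
    (γ : Matrix (Fin n) (Fin n) ℝ) (y : State n N) : ℝ :=
  1 / 2 * ∑ j : Fin (2 * N + 1), freq a b j ^ 2 * (y.col j ⬝ᵥ beta2 β *ᵥ y.col j) -
    1 / 8 * ∫ x in a..b,
      (matQ n *ᵥ (y *ᵥ basisVec a b N x) ^ 2) ⬝ᵥ
        (gamma2 γ *ᵥ (matQ n *ᵥ (y *ᵥ basisVec a b N x) ^ 2))

end Manakov

/-! One step of the method is governed by a polynomial path of degree at most `s`, `σ(c) = y₀ + h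
∑_{j<s} (∫₀^c P_j) γ_j` with `γ_j = ∑ₗ b_l P_j(c_l) f(Y_l)`. The coefficients `a_il` are chosen so
that `σ(c_i) = Y_i`, and `σ(1) = y₁` because `∫₀¹ P_j = 0` for `j ≥ 1`. The field is a cubic
polynomial map, the Hamiltonian a quartic one, and the Gauss formula with `2s` nodes is exact in
degrees below `4s`; all integrals over `c` that matter are therefore computed exactly.

Energy. `H ∘ σ` has degree at most `4s`, so its increment over `[0, 1]` equals `∑ₗ b_l ∇H(Y_l) ·
σ'(c_l)` (`hamiltonian_sub_eq`). As `f = J ∇H`, one has `σ' = h ∑_j P_j J g_j` with `g_j = ∑ₗ b_l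
P_j(c_l) ∇H(Y_l)`. The increment is `h ∑_j g_j · J g_j`, which vanishes since `J` is skew-symmetric.

Local order. `P_j · f(σ)` has degree below `4s`, so `γ_j` is the true Legendre coefficient of `f(σ)`
and `σ' = h Π f(σ)`, with `Π` the `L²` projection onto degree less than `s`
(`stagePath_integral_eq`). The rescaled exact solution `v(c) = y(hc)` satisfies `v' = h f(v)`. The
difference `e = σ - v` thus solves a linear equation `e' = h (A e + r)`, with `A` made of divided
differences and `r = Π f(σ) - f(σ)`. Up to `O(h^s)`, `f(σ)` and `A` are polynomials in `hc` with
bounded coefficients; hence `r = O(h^s)` and, by orthogonality, `∫ G r = O(h^(2s))` for every such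
`G`. In place of a resolvent, the integral equation is substituted into `∫ A e` repeatedly: each
integration by parts gives the weight on `e` one more power of `h`, until it is `O(h^s)` and meets
`e = O(h^s)`. This yields `e(1) = O(h^(2s+1))` (`uniformO_endpoint`).

Global order follows from the local estimate, Lipschitz stability of one step and a discrete
Gronwall argument (`HasLocalOrder.hasGlobalOrder`). -/

namespace HBVM

open Polynomial

/-! ### Orthonormality of the shifted Legendre polynomials. -/

theorem integral_derivative_eval (p : ℝ[X]) :
    ∫ x in (0 : ℝ)..1, (derivative p).eval x = p.eval 1 - p.eval 0 :=
  intervalIntegral.integral_eq_sub_of_hasDerivAt (fun x _ => p.hasDerivAt x)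
    ((derivative p).continuous.intervalIntegrable _ _)

theorem intervalIntegrable_eval (p : ℝ[X]) (a b : ℝ) :
    IntervalIntegrable (fun x => p.eval x) MeasureTheory.volume a b :=
  p.continuous.intervalIntegrable a b

/-- Since `x^(a+1) (1-x)^(b+1)` vanishes at both ends, integrating its derivative trades a factor `1
- x` for a factor `x`. The value fixes the normalization of the Legendre polynomials. -/
theorem integral_pow_mul_one_sub_pow (a b : ℕ) :
    ∫ x in (0 : ℝ)..1, x ^ a * (1 - x) ^ b =
      (a.factorial * b.factorial : ℝ) / (a + b + 1).factorial := by
  induction b generalizing a with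
  | zero =>
    simp only [pow_zero, mul_one, integral_pow, Nat.factorial, Nat.cast_one]
    have : (a.factorial : ℝ) ≠ 0 := by positivity
    push_cast
    field_simp
    simp
  | succ b ih =>
    have h := integral_derivative_eval (X ^ (a + 1) * (1 - X) ^ (b + 1))
    have h2 : ∀ x : ℝ, (derivative (X ^ (a + 1) * (1 - X) ^ (b + 1) : ℝ[X])).eval x =
        (a + 1) * (x ^ a * (1 - x) ^ (b + 1)) - (b + 1) * (x ^ (a + 1) * (1 - x) ^ b) := by
      intro x
      simp [derivative_mul, derivative_pow]
      ring
    simp_rw [h2] at h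
    rw [intervalIntegral.integral_sub, intervalIntegral.integral_const_mul,
      intervalIntegral.integral_const_mul, ih] at h
    · simp only [eval_mul, eval_pow, eval_X, eval_sub, eval_one, sub_self, ne_eq,
        Nat.add_eq_zero_iff, one_ne_zero, and_false, not_false_eq_true, zero_pow, mul_zero, sub_zero,
        zero_mul] at h
      have e : a + 1 + b + 1 = a + (b + 1) + 1 := by ring
      rw [e] at h
      have h3 : ((a : ℝ) + 1) ≠ 0 := by positivity
      rw [← mul_right_inj' h3, sub_eq_zero.mp h, Nat.factorial_succ a, Nat.factorial_succ b]
      push_cast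
      ring
    all_goals exact (by fun_prop : Continuous _).intervalIntegrable _ _

/-- Iterated integration by parts against a polynomial with zeros of order `n` at `0` and `1`. -/
theorem integral_iterate_derivative_mul {n : ℕ} {w : ℝ[X]} (h0 : X ^ n ∣ w)
    (h1 : (X - C 1) ^ n ∣ w) {m : ℕ} (hm : m ≤ n) (q : ℝ[X]) :
    ∫ x in (0 : ℝ)..1, (derivative^[m] w * q).eval x =
      (-1) ^ m * ∫ x in (0 : ℝ)..1, (w * derivative^[m] q).eval x := by
  induction m generalizing q with
  | zero => simp
  | succ m ih =>
    have e0 : (derivative^[m] w).eval 0 = 0 := by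
      have := pow_sub_dvd_iterate_derivative_of_pow_dvd m h0
      obtain ⟨t, ht⟩ := (dvd_pow_self X (by omega : n - m ≠ 0)).trans this
      simp [ht]
    have e1 : (derivative^[m] w).eval 1 = 0 := by
      have := pow_sub_dvd_iterate_derivative_of_pow_dvd m h1
      obtain ⟨t, ht⟩ := (dvd_pow_self (X - C 1) (by omega : n - m ≠ 0)).trans this
      simp [ht]
    have h := integral_derivative_eval (derivative^[m] w * q)
    simp only [derivative_mul, eval_add] at h
    rw [intervalIntegral.integral_add (intervalIntegrable_eval _ _ _)
      (intervalIntegrable_eval _ _ _), ih (by omega)] at h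
    rw [eval_mul, eval_mul, e0, e1] at h
    rw [Function.iterate_succ_apply', Function.iterate_succ_apply, pow_succ]
    linarith

theorem factorial_mul_map_shiftedLegendre (n : ℕ) :
    (n.factorial : ℝ[X]) * (shiftedLegendre n).map (Int.castRingHom ℝ) =
      derivative^[n] (X ^ n * (1 - X) ^ n) := by
  have := congrArg (Polynomial.map (Int.castRingHom ℝ)) (factorial_mul_shiftedLegendre_eq n)
  simpa [← iterate_derivative_map] using this

/-- By Rodrigues' formula, `n` integrations by parts leave the constant `q⁽ⁿ⁾ = n! · q.coeff n`
against a Beta integral. Orthogonality and the norm are both special cases. -/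
theorem integral_shiftedLegendre_mul (n : ℕ) (q : ℝ[X]) (hq : q.natDegree ≤ n) :
    ∫ x in (0 : ℝ)..1, ((shiftedLegendre n).map (Int.castRingHom ℝ) * q).eval x =
      (-1) ^ n * q.coeff n * ((n.factorial : ℝ) ^ 2 / (2 * n + 1).factorial) := by
  have hf : (n.factorial : ℝ) ≠ 0 := by positivity
  have h := integral_iterate_derivative_mul (n := n) (w := X ^ n * (1 - X) ^ n)
    (dvd_mul_right _ _) ⟨X ^ n * (-1) ^ n, by
      rw [show (1 : ℝ[X]) - X = (X - C 1) * (-1) by simp, mul_pow]; ring⟩ le_rfl q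
  have hd : derivative^[n] q = C (n.factorial * q.coeff n) := by
    have : (derivative^[n] q).natDegree = 0 := by
      have := natDegree_iterate_derivative q n
      omega
    rw [eq_C_of_natDegree_eq_zero this, coeff_iterate_derivative]
    simp [Nat.descFactorial_self]
  rw [← factorial_mul_map_shiftedLegendre, hd] at h
  simp only [eval_mul, eval_natCast, eval_pow, eval_X, eval_sub, eval_one, eval_C, mul_assoc] at h
  rw [intervalIntegral.integral_const_mul] at h
  simp only [← mul_assoc] at h
  rw [intervalIntegral.integral_mul_const, intervalIntegral.integral_mul_const,
    integral_pow_mul_one_sub_pow, ← two_mul] at h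
  simp only [eval_mul]
  rw [← mul_right_inj' hf, h]
  ring

theorem natDegree_map_shiftedLegendre (n : ℕ) :
    ((shiftedLegendre n).map (Int.castRingHom ℝ)).natDegree = n := by
  rw [natDegree_map_eq_of_injective Int.cast_injective, natDegree_shiftedLegendre]

theorem legendre_scale_ne_zero (n : ℕ) : ((-1) ^ n * √(2 * n + 1) : ℝ) ≠ 0 := by
  have : 0 < √(2 * n + 1 : ℝ) := Real.sqrt_pos.2 (by positivity)
  exact mul_ne_zero (pow_ne_zero _ (by norm_num)) this.ne'

theorem natDegree_legendre (n : ℕ) : (legendre n).natDegree = n := by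
  rw [legendre, natDegree_C_mul (legendre_scale_ne_zero n), natDegree_map_shiftedLegendre]

theorem legendre_zero : legendre 0 = 1 := by
  simp [legendre, shiftedLegendre]

theorem integral_legendre_mul (n : ℕ) (q : ℝ[X]) (hq : q.natDegree < n) :
    ∫ x in (0 : ℝ)..1, (legendre n).eval x * q.eval x = 0 := by
  have := integral_shiftedLegendre_mul n q hq.le
  rw [coeff_eq_zero_of_natDegree_lt hq] at this
  simp only [legendre, eval_mul, eval_C, mul_assoc, intervalIntegral.integral_const_mul] at this ⊢
  simp [this]

theorem integral_legendre_mul_self (n : ℕ) :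
    ∫ x in (0 : ℝ)..1, (legendre n).eval x * (legendre n).eval x = 1 := by
  have h := integral_shiftedLegendre_mul n _ (natDegree_map_shiftedLegendre n).le
  have e : ∀ x : ℝ, (legendre n).eval x * (legendre n).eval x =
      (2 * n + 1) * ((shiftedLegendre n).map (Int.castRingHom ℝ) *
        (shiftedLegendre n).map (Int.castRingHom ℝ)).eval x := by
    intro x
    have h2 : √(2 * n + 1 : ℝ) ^ 2 = 2 * n + 1 := Real.sq_sqrt (by positivity)
    have h3 : ((-1 : ℝ) ^ n) ^ 2 = 1 := by rw [← pow_mul, mul_comm, pow_mul]; simp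
    simp only [legendre, eval_mul, eval_C]
    linear_combination (((shiftedLegendre n).map (Int.castRingHom ℝ)).eval x) ^ 2 *
      (√(2 * n + 1 : ℝ) ^ 2 * h3 + h2)
  simp_rw [e]
  rw [intervalIntegral.integral_const_mul, h, coeff_map, coeff_shiftedLegendre]
  have h3 : ((-1 : ℝ) ^ n) * (-1) ^ n = 1 := by rw [← mul_pow]; simp
  have h4 := Nat.add_choose_mul_factorial_mul_factorial n n
  have h5 : ((2 * n + 1).factorial : ℝ) = (2 * n + 1) * ((n + n).choose n * n.factorial * n.factorial) := by
    rw [Nat.factorial_succ, two_mul, ← h4]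
    push_cast
    ring
  rw [h5]
  have : ((n + n).choose n : ℝ) ≠ 0 := by
    exact_mod_cast (Nat.choose_pos (by omega)).ne'
  have hf : (n.factorial : ℝ) ≠ 0 := by positivity
  have h6 : (2 * n + 1 : ℝ) ≠ 0 := by positivity
  simp only [Nat.choose_self, eq_intCast]
  push_cast
  field_simp
  linear_combination h3

theorem integral_legendre_mul_legendre (i j : ℕ) :
    ∫ x in (0 : ℝ)..1, (legendre i).eval x * (legendre j).eval x = if i = j then 1 else 0 := by
  rcases lt_trichotomy i j with h | rfl | h
  · rw [if_neg h.ne]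
    simp_rw [mul_comm ((legendre i).eval _)]
    exact integral_legendre_mul j _ (by rwa [natDegree_legendre])
  · simp [integral_legendre_mul_self]
  · rw [if_neg h.ne']
    exact integral_legendre_mul i _ (by rwa [natDegree_legendre])

/-- Polynomials of degree less than `s` are reproduced by their Legendre expansion. -/
theorem sum_legendre_expansion (s : ℕ) (q : ℝ[X]) (hq : q.degree < s) :
    ∑ j ∈ Finset.range s, C (∫ x in (0 : ℝ)..1, (legendre j).eval x * q.eval x) * legendre j =
      q := by
  induction s generalizing q with
  | zero =>
    have : q = 0 := by simpa using hq
    simp [this]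
  | succ s ih =>
    have hne : (legendre s).coeff s ≠ 0 := by
      have : (legendre s).leadingCoeff ≠ 0 := by
        rw [leadingCoeff_ne_zero, legendre]
        refine mul_ne_zero (C_ne_zero.2 (legendre_scale_ne_zero s)) fun h => ?_
        rw [Polynomial.map_eq_zero_iff Int.cast_injective] at h
        have := degree_shiftedLegendre s
        simp [h] at this
      rwa [leadingCoeff, natDegree_legendre] at this
    -- The multiple of `legendre s` that cancels the coefficient of degree `s`, leaving a remainder
    -- for the induction hypothesis.
    set t := q.coeff s / (legendre s).coeff s with ht
    set r := q - C t * legendre s with hr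
    have hr' : r.degree < s := by
      rw [degree_lt_iff_coeff_zero]
      intro m hm
      rcases hm.eq_or_lt with rfl | hm
      · simp [hr, ht, hne]
      · rw [hr, coeff_sub, coeff_C_mul, coeff_eq_zero_of_natDegree_lt
          (p := legendre s) (by rwa [natDegree_legendre]), (degree_lt_iff_coeff_zero _ _).1 hq m hm]
        simp
    have hq' : q = r + C t * legendre s := by simp [hr]
    have hint : ∀ j, ∫ x in (0 : ℝ)..1, (legendre j).eval x * q.eval x =
        (∫ x in (0 : ℝ)..1, (legendre j).eval x * r.eval x) + t * if j = s then 1 else 0 := by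
      intro j
      rw [← integral_legendre_mul_legendre, ← intervalIntegral.integral_const_mul,
        ← intervalIntegral.integral_add
          (Continuous.intervalIntegrable (by fun_prop) _ _)
          (Continuous.intervalIntegrable (by fun_prop) _ _)]
      congr 1
      ext x
      rw [hq']
      simp
      ring
    have hs : ∫ x in (0 : ℝ)..1, (legendre s).eval x * r.eval x = 0 := by
      by_cases h0 : r = 0
      · simp [h0]
      · exact integral_legendre_mul s r ((natDegree_lt_iff_degree_lt h0).2 hr')
    rw [Finset.sum_range_succ, hint s, hs]
    conv_rhs => rw [hq', ← ih r hr']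
    congr 1
    · refine Finset.sum_congr rfl fun j hj => ?_
      rw [hint j, if_neg (Finset.mem_range.1 hj).ne]
      simp
    · simp

/-! ### Simple real zeros of the Legendre polynomials. -/

theorem iterate_derivative_bernstein_ne_zero (n m : ℕ) (hm : m ≤ n) :
    derivative^[m] (X ^ n * (1 - X) ^ n : ℝ[X]) ≠ 0 := by
  intro h
  have h1 : derivative^[n] (X ^ n * (1 - X) ^ n : ℝ[X]) = 0 := by
    rw [← Nat.sub_add_cancel hm, Function.iterate_add_apply]
    rw [Nat.sub_add_cancel hm, h, iterate_derivative_zero]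
  rw [← factorial_mul_map_shiftedLegendre, mul_eq_zero] at h1
  rcases h1 with h1 | h1
  · exact n.factorial_ne_zero (by exact_mod_cast h1)
  · rw [Polynomial.map_eq_zero_iff Int.cast_injective] at h1
    have := degree_shiftedLegendre n
    simp [h1] at this

theorem zero_mem_roots_iterate_derivative (n m : ℕ) (hm : m < n) :
    (0 : ℝ) ∈ (derivative^[m] (X ^ n * (1 - X) ^ n : ℝ[X])).roots.toFinset := by
  rw [Multiset.mem_toFinset, mem_roots (iterate_derivative_bernstein_ne_zero n m hm.le)]
  obtain ⟨t, ht⟩ := (dvd_pow_self X (by omega : n - m ≠ 0)).trans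
    (pow_sub_dvd_iterate_derivative_of_pow_dvd m
      (dvd_mul_right (X ^ n) ((1 - X) ^ n : ℝ[X])))
  simp [ht]

theorem one_mem_roots_iterate_derivative (n m : ℕ) (hm : m < n) :
    (1 : ℝ) ∈ (derivative^[m] (X ^ n * (1 - X) ^ n : ℝ[X])).roots.toFinset := by
  rw [Multiset.mem_toFinset, mem_roots (iterate_derivative_bernstein_ne_zero n m hm.le)]
  obtain ⟨t, ht⟩ := (dvd_pow_self (1 - X) (by omega : n - m ≠ 0)).trans
    (pow_sub_dvd_iterate_derivative_of_pow_dvd m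
      (dvd_mul_left ((1 - X) ^ n : ℝ[X]) (X ^ n)))
  simp [ht]

/-- By Rolle, a polynomial with `r` distinct roots has at least `r - 1` roots of its derivative that
are not its own roots. As long as the order of differentiation is below `n`, the points `0` and `1`
are roots too, so each derivative gains at least one distinct root. -/
theorem card_roots_iterate_derivative (n m : ℕ) (hm : m < n) :
    m + 2 ≤ (derivative^[m] (X ^ n * (1 - X) ^ n : ℝ[X])).roots.toFinset.card := by
  induction m with
  | zero =>
    refine le_trans ?_ (Finset.card_le_card (Finset.insert_subset
      (zero_mem_roots_iterate_derivative n 0 hm)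
      (Finset.singleton_subset_iff.2 (one_mem_roots_iterate_derivative n 0 hm))))
    simp
  | succ m ih =>
    have h := card_roots_toFinset_le_card_roots_derivative_sdiff_roots_succ
      (derivative^[m] (X ^ n * (1 - X) ^ n : ℝ[X]))
    rw [← Function.iterate_succ_apply' derivative] at h
    set S := (derivative^[m] (X ^ n * (1 - X) ^ n : ℝ[X])).roots.toFinset with hS
    set T := (derivative^[m + 1] (X ^ n * (1 - X) ^ n : ℝ[X])).roots.toFinset with hT
    have hS2 : ({0, 1} : Finset ℝ) ⊆ S := Finset.insert_subset
      (zero_mem_roots_iterate_derivative n m (by omega))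
      (Finset.singleton_subset_iff.2 (one_mem_roots_iterate_derivative n m (by omega)))
    have hT2 : ({0, 1} : Finset ℝ) ⊆ T := Finset.insert_subset
      (zero_mem_roots_iterate_derivative n (m + 1) hm)
      (Finset.singleton_subset_iff.2 (one_mem_roots_iterate_derivative n (m + 1) hm))
    have hdisj : Disjoint (T \ S) {0, 1} :=
      Finset.disjoint_left.2 fun x hx hx' => (Finset.mem_sdiff.1 hx).2 (hS2 hx')
    have := Finset.card_le_card (Finset.union_subset Finset.sdiff_subset hT2 : T \ S ∪ {0, 1} ⊆ T)
    rw [Finset.card_union_of_disjoint hdisj, Finset.card_pair zero_ne_one] at this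
    have := ih (by omega)
    omega

theorem roots_legendre (n : ℕ) : (legendre n).roots =
    (derivative^[n] (X ^ n * (1 - X) ^ n : ℝ[X])).roots := by
  rw [← factorial_mul_map_shiftedLegendre, legendre, roots_C_mul _ (legendre_scale_ne_zero n),
    ← C_eq_natCast, roots_C_mul _ (by positivity)]

/-- One last application of Rolle, where the endpoints are no longer counted: the `n + 2` roots of
the `n`-th derivative of `X^(n+1) (1-X)^(n+1)` give `n + 1` roots of the next one. -/
theorem card_toFinset_roots_legendre (n : ℕ) : (legendre n).roots.toFinset.card = n := by
  apply le_antisymm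
  · exact (Multiset.toFinset_card_le _).trans ((card_roots' _).trans (natDegree_legendre n).le)
  · rcases n with _ | n
    · simp
    · rw [roots_legendre]
      have h := card_roots_toFinset_le_card_roots_derivative_sdiff_roots_succ
        (derivative^[n] (X ^ (n + 1) * (1 - X) ^ (n + 1) : ℝ[X]))
      rw [← Function.iterate_succ_apply' derivative, Nat.succ_eq_add_one] at h
      have h2 := card_roots_iterate_derivative (n + 1) n (by omega)
      have h3 := Finset.card_le_card (Finset.sdiff_subset
        (s := (derivative^[n + 1] (X ^ (n + 1) * (1 - X) ^ (n + 1) : ℝ[X])).roots.toFinset)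
        (t := (derivative^[n] (X ^ (n + 1) * (1 - X) ^ (n + 1) : ℝ[X])).roots.toFinset))
      omega

theorem card_roots_legendre (n : ℕ) : (legendre n).roots.card = n := by
  apply le_antisymm
  · exact (card_roots' _).trans (natDegree_legendre n).le
  · exact (card_toFinset_roots_legendre n).symm.le.trans (Multiset.toFinset_card_le _)

theorem nodup_roots_legendre (n : ℕ) : (legendre n).roots.Nodup := by
  rw [← Multiset.toFinset_card_eq_card_iff_nodup, card_toFinset_roots_legendre,
    card_roots_legendre]

/-! ### Gauss nodes and exactness of the Gauss formula. -/

theorem gaussNode_eq_get (k : ℕ) (i : Fin k) : ∃ h, gaussNode k i =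
    ((legendre k).roots.sort (· ≤ ·))[(i : ℕ)]'h := by
  -- The list of roots has length exactly `k`, so the default value `0` in `gaussNode` is never
  -- returned.
  have h : (i : ℕ) < ((legendre k).roots.sort (· ≤ ·)).length := by
    rw [Multiset.length_sort, card_roots_legendre]
    exact i.2
  exact ⟨h, List.getD_eq_getElem _ _ h⟩

theorem gaussNode_injective (k : ℕ) : Function.Injective (gaussNode k) := by
  intro i j hij
  obtain ⟨hi, ei⟩ := gaussNode_eq_get k i
  obtain ⟨hj, ej⟩ := gaussNode_eq_get k j
  rw [ei, ej] at hij
  have hn : ((legendre k).roots.sort (· ≤ ·)).Nodup := by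
    rw [← Multiset.coe_nodup, Multiset.sort_eq]
    exact nodup_roots_legendre k
  exact Fin.ext ((hn.getElem_inj_iff).1 hij)

theorem eval_legendre_gaussNode (k : ℕ) (i : Fin k) : (legendre k).eval (gaussNode k i) = 0 := by
  obtain ⟨hi, ei⟩ := gaussNode_eq_get k i
  have : gaussNode k i ∈ (legendre k).roots := by
    rw [← Multiset.mem_sort (· ≤ ·), ei]
    exact List.getElem_mem _
  exact isRoot_of_mem_roots this

theorem legendre_ne_zero (k : ℕ) : legendre k ≠ 0 := by
  intro h
  have := integral_legendre_mul_self k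
  simp [h] at this

/-- The `k`-point Gauss formula is exact for polynomials of degree less than `2 k`. -/
theorem gauss_exact (k : ℕ) (p : ℝ[X]) (hp : p.degree < (2 * k : ℕ)) :
    ∫ x in (0 : ℝ)..1, p.eval x = ∑ i, gaussWeight k i * p.eval (gaussNode k i) := by
  have hdeg : (legendre k).degree = k := by
    rw [degree_eq_natDegree (legendre_ne_zero k), natDegree_legendre]
  -- The part `legendre k * q` contributes nothing to either side: `q` has degree below `k`, and the
  -- nodes are roots of `legendre k`. The remainder has degree below `k` and equals its own Lagrange
  -- interpolant.
  set q := p / legendre k with hq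
  set r := p % legendre k with hr
  have hpqr : p = legendre k * q + r := (EuclideanDomain.div_add_mod p (legendre k)).symm
  have hrdeg : r.degree < k := hdeg ▸ EuclideanDomain.mod_lt p (legendre_ne_zero k)
  have hint : ∫ x in (0 : ℝ)..1, p.eval x = ∫ x in (0 : ℝ)..1, r.eval x := by
    have h0 : ∫ x in (0 : ℝ)..1, (legendre k).eval x * q.eval x = 0 := by
      by_cases hq0 : q = 0
      · simp [hq0]
      · refine integral_legendre_mul k q ?_
        by_contra! hk
        have h1 : (legendre k * q).natDegree = k + q.natDegree := by
          rw [natDegree_mul (legendre_ne_zero k) hq0, natDegree_legendre]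
        have h2 : (legendre k * q).degree < (2 * k : ℕ) := by
          have : legendre k * q = p - r := by rw [hpqr]; ring
          rw [this]
          refine (degree_sub_le _ _).trans_lt (max_lt hp (hrdeg.trans_le ?_))
          exact_mod_cast (by omega : k ≤ 2 * k)
        have h3 := (natDegree_lt_iff_degree_lt (mul_ne_zero (legendre_ne_zero k) hq0)).2 h2
        omega
    conv_lhs => rw [hpqr]
    simp only [eval_add, eval_mul]
    rw [intervalIntegral.integral_add (Continuous.intervalIntegrable (by fun_prop) _ _)
      (intervalIntegrable_eval _ _ _), h0, zero_add]
  have heval : ∀ i, p.eval (gaussNode k i) = r.eval (gaussNode k i) := by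
    intro i
    conv_lhs => rw [hpqr]
    simp [eval_legendre_gaussNode]
  have hlag : r = Lagrange.interpolate Finset.univ (gaussNode k)
      fun i => r.eval (gaussNode k i) :=
    Lagrange.eq_interpolate (gaussNode_injective k).injOn (by simpa using hrdeg)
  rw [hint]
  simp_rw [heval]
  conv_lhs => rw [hlag]
  simp only [Lagrange.interpolate_apply, eval_finsetSum, eval_mul, eval_C]
  rw [intervalIntegral.integral_finsetSum
    fun i _ => Continuous.intervalIntegrable (by fun_prop) _ _]
  refine Finset.sum_congr rfl fun i _ => ?_
  rw [intervalIntegral.integral_const_mul, gaussWeight, mul_comm]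

end HBVM

/-! ### General Runge–Kutta theory: solvability, stability, and convergence from consistency. -/

namespace RungeKutta

section

open Metric NNReal

variable {E : Type*} [NormedAddCommGroup E] [NormedSpace ℝ E] {k : ℕ}

theorem norm_sum_smul_sub_le {K : ℝ≥0} {f : E → E} {r : ℝ}
    (hf : LipschitzOnWith K f (closedBall 0 r)) (α : Fin k → ℝ) {Y Z : Fin k → E} {d a : ℝ}
    (ha : ∑ j, |α j| ≤ a) (hY : ∀ j, ‖Y j‖ ≤ r) (hZ : ∀ j, ‖Z j‖ ≤ r) (hd : 0 ≤ d)
    (hYZ : ∀ j, ‖Y j - Z j‖ ≤ d) :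
    ‖∑ j, α j • f (Y j) - ∑ j, α j • f (Z j)‖ ≤ a * K * d := by
  rw [← Finset.sum_sub_distrib]
  calc ‖∑ j, (α j • f (Y j) - α j • f (Z j))‖
      ≤ ∑ j, |α j| * (K * d) := by
        refine norm_sum_le_of_le _ fun j _ => ?_
        rw [← smul_sub, norm_smul, Real.norm_eq_abs]
        gcongr
        refine (hf.norm_sub_le (by simpa using hY j) (by simpa using hZ j)).trans ?_
        gcongr
        exact hYZ j
    _ ≤ a * K * d := by
        rw [← Finset.sum_mul, mul_assoc]
        gcongr

theorem row_sum_le (A : Matrix (Fin k) (Fin k) ℝ) (i : Fin k) :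
    ∑ j, |A i j| ≤ ∑ i, ∑ j, |A i j| :=
  Finset.single_le_sum (f := fun i => ∑ j, |A i j|)
    (fun _ _ => Finset.sum_nonneg fun _ _ => abs_nonneg _) (Finset.mem_univ i)

/-- For small stepsizes the stages depend Lipschitz continuously on the initial value. -/
theorem IsStages.norm_sub_le (M : Tableau k) {K : ℝ≥0} {f : E → E} {r h : ℝ}
    (hf : LipschitzOnWith K f (closedBall 0 r)) (hh : 0 ≤ h)
    (hsmall : h * ((∑ i, ∑ j, |M.A i j|) * K) ≤ 1 / 2) {y z : E} {Y Z : Fin k → E}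
    (hY : IsStages M f h y Y) (hZ : IsStages M f h z Z)
    (hYr : ∀ j, ‖Y j‖ ≤ r) (hZr : ∀ j, ‖Z j‖ ≤ r) (i : Fin k) :
    ‖Y i - Z i‖ ≤ 2 * ‖y - z‖ := by
  -- The last term is absorbed on the left, whence the factor `2`.
  have key : ‖Y - Z‖ ≤ ‖y - z‖ + 1 / 2 * ‖Y - Z‖ := by
    refine (pi_norm_le_iff_of_nonneg (by positivity)).2 fun i => ?_
    have e : (Y - Z) i = (y - z) +
        h • (∑ j, M.A i j • f (Y j) - ∑ j, M.A i j • f (Z j)) := by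
      rw [Pi.sub_apply, hY i, hZ i, smul_sub]
      abel
    rw [e]
    refine (norm_add_le _ _).trans (add_le_add_right ?_ _)
    rw [norm_smul, Real.norm_of_nonneg hh]
    calc h * _ ≤ h * ((∑ i, ∑ j, |M.A i j|) * K * ‖Y - Z‖) := by
          gcongr
          exact norm_sum_smul_sub_le hf _ (row_sum_le M.A i) hYr hZr (norm_nonneg _)
            fun j => norm_le_pi_norm (Y - Z) j
      _ = (h * ((∑ i, ∑ j, |M.A i j|) * K)) * ‖Y - Z‖ := by ring
      _ ≤ _ := by gcongr
  have := norm_le_pi_norm (Y - Z) i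
  rw [Pi.sub_apply] at this
  linarith

theorem norm_update_sub_le (M : Tableau k) {K : ℝ≥0} {f : E → E} {r h : ℝ}
    (hf : LipschitzOnWith K f (closedBall 0 r)) (hh : 0 ≤ h)
    (hsmall : h * ((∑ i, ∑ j, |M.A i j|) * K) ≤ 1 / 2) {y z : E} {Y Z : Fin k → E}
    (hY : IsStages M f h y Y) (hZ : IsStages M f h z Z)
    (hYr : ∀ j, ‖Y j‖ ≤ r) (hZr : ∀ j, ‖Z j‖ ≤ r) :
    ‖update M f h y Y - update M f h z Z‖ ≤ (1 + h * (2 * (∑ j, |M.b j|) * K)) * ‖y - z‖ := by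
  have e : update M f h y Y - update M f h z Z = (y - z) +
      h • (∑ j, M.b j • f (Y j) - ∑ j, M.b j • f (Z j)) := by
    rw [update, update, smul_sub]
    abel
  rw [e]
  refine (norm_add_le _ _).trans ?_
  rw [norm_smul, Real.norm_of_nonneg hh]
  have := norm_sum_smul_sub_le hf M.b le_rfl hYr hZr (by positivity)
    (hY.norm_sub_le M hf hh hsmall hZ hYr hZr)
  have := mul_le_mul_of_nonneg_left this hh
  linarith

theorem IsStagesNear.norm_le {M : Tableau k} {f : E → E} {R ρ h : ℝ} {y : E} {Y : Fin k → E}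
    (hY : IsStagesNear M f ρ h y Y) (hy : ‖y‖ ≤ R) (j : Fin k) : ‖Y j‖ ≤ R + ρ := by
  have := norm_add_le y (Y j - y)
  rw [add_sub_cancel] at this
  linarith [hY.2 j]

theorem exists_small {a c : ℝ} (ha : 0 ≤ a) (hc : 0 < c) :
    ∃ h₀ > 0, ∀ h, 0 < h → h ≤ h₀ → h * a ≤ c := by
  refine ⟨c / (a + 1), by positivity, fun h h0 h1 => ?_⟩
  rw [le_div_iff₀ (by positivity)] at h1
  linarith

theorem norm_le_of_lipschitzOnWith {F : Type*} [NormedAddCommGroup F] {K : ℝ≥0} {f : F → F} {r : ℝ} (hr : 0 ≤ r)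
    (hf : LipschitzOnWith K f (closedBall 0 r)) {x : F} (hx : ‖x‖ ≤ r) :
    ‖f x‖ ≤ ‖f 0‖ + K * r := by
  have h1 := hf.norm_sub_le (x := x) (y := 0) (by simpa using hx) (by simpa using hr)
  have h2 := norm_add_le (f 0) (f x - f 0)
  rw [add_sub_cancel] at h2
  rw [sub_zero] at h1
  have : (K : ℝ) * ‖x‖ ≤ K * r := by gcongr
  linarith

/-- Unique solvability of the stage equations near the initial value, for small stepsizes. -/
theorem existsUnique_isStagesNear [CompleteSpace E] (M : Tableau k) {f : E → E}
    (hf : ∀ r, ∃ K : ℝ≥0, LipschitzOnWith K f (closedBall 0 r)) {R ρ : ℝ} (hR : 0 < R)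
    (hρ : 0 < ρ) :
    ∃ h₀ > 0, ∀ y₀ : E, ‖y₀‖ ≤ R → ∀ h ∈ Set.Ioc 0 h₀, ∃! Y, IsStagesNear M f ρ h y₀ Y := by
  obtain ⟨K, hK⟩ := hf (R + ρ)
  set a := ∑ i, ∑ j, |M.A i j| with ha
  have ha0 : 0 ≤ a := Finset.sum_nonneg fun _ _ => Finset.sum_nonneg fun _ _ => abs_nonneg _
  set B := ‖f 0‖ + K * (R + ρ) with hB
  -- `B` bounds `f` on the ball of radius `R + ρ`. The condition `h a B ≤ ρ` makes the stage map
  -- preserve the `ρ`-ball, and `h a K ≤ 1/2` makes it a contraction there.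
  obtain ⟨h₁, h₁0, H₁⟩ := exists_small (a := a * B) (by positivity) hρ
  obtain ⟨h₂, h₂0, H₂⟩ := exists_small (a := a * K) (by positivity)
    (by norm_num : (0 : ℝ) < 1 / 2)
  refine ⟨min h₁ h₂, lt_min h₁0 h₂0, fun y₀ hy₀ h hh => ?_⟩
  have hh0 : 0 < h := hh.1
  have hs1 := H₁ h hh0 (hh.2.trans (min_le_left _ _))
  have hs2 := H₂ h hh0 (hh.2.trans (min_le_right _ _))
  set S : Set (Fin k → E) := closedBall (fun _ => y₀) ρ with hS
  have hmem : ∀ Y, Y ∈ S ↔ ∀ i, ‖Y i - y₀‖ ≤ ρ := fun Y => by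
    rw [hS, mem_closedBall, dist_eq_norm, pi_norm_le_iff_of_nonneg hρ.le]
    rfl
  have hnorm : ∀ Y ∈ S, ∀ i, ‖Y i‖ ≤ R + ρ := fun Y hY i => by
    have := norm_add_le y₀ (Y i - y₀)
    rw [add_sub_cancel] at this
    linarith [(hmem Y).1 hY i]
  set Φ : (Fin k → E) → Fin k → E := fun Y i => y₀ + h • ∑ j, M.A i j • f (Y j) with hΦ
  have hmaps : Set.MapsTo Φ S S := fun Y hY => by
    rw [hmem]
    intro i
    simp only [hΦ, add_sub_cancel_left]
    rw [norm_smul, Real.norm_of_nonneg hh0.le]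
    refine le_trans ?_ hs1
    gcongr
    calc ‖∑ j, M.A i j • f (Y j)‖ ≤ ∑ j, |M.A i j| * B := by
          refine norm_sum_le_of_le _ fun j _ => ?_
          rw [norm_smul, Real.norm_eq_abs]
          gcongr
          exact norm_le_of_lipschitzOnWith (by positivity) hK (hnorm Y hY j)
      _ ≤ a * B := by
          rw [← Finset.sum_mul]
          gcongr
          exact row_sum_le M.A i
  have hcontr : ContractingWith (1 / 2) (hmaps.restrict Φ S S) := by
    refine ⟨by rw [← NNReal.coe_lt_coe]; norm_num, LipschitzWith.of_dist_le_mul ?_⟩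
    rintro ⟨Y, hY⟩ ⟨Z, hZ⟩
    rw [Subtype.dist_eq, Subtype.dist_eq]
    change dist (Φ Y) (Φ Z) ≤ _ * dist Y Z
    rw [dist_eq_norm, dist_eq_norm]
    refine (pi_norm_le_iff_of_nonneg (by positivity)).2 fun i => ?_
    simp only [Pi.sub_apply, hΦ, add_sub_add_left_eq_sub]
    rw [← smul_sub, norm_smul, Real.norm_of_nonneg hh0.le]
    have := norm_sum_smul_sub_le hK _ (row_sum_le M.A i) (hnorm Y hY) (hnorm Z hZ)
      (norm_nonneg _) fun j => norm_le_pi_norm (Y - Z) j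
    calc h * _ ≤ h * (a * K * ‖Y - Z‖) := by gcongr
      _ = (h * (a * K)) * ‖Y - Z‖ := by ring
      _ ≤ (1 / 2) * ‖Y - Z‖ := by gcongr
      _ = _ := by norm_num
  obtain ⟨Y, hYS, hYfix, -⟩ := hcontr.exists_fixedPoint' isClosed_closedBall.isComplete hmaps
    (mem_closedBall_self hρ.le) (edist_ne_top _ _)
  have hYst : IsStages M f h y₀ Y := fun i => (congrFun hYfix i).symm
  refine ⟨Y, ⟨hYst, (hmem Y).1 hYS⟩, fun Z hZ => ?_⟩
  funext i
  have := hZ.1.norm_sub_le M hK hh0.le hs2 hYst (hnorm Z ((hmem Z).2 hZ.2)) (hnorm Y hYS) i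
  rw [sub_self, norm_zero, mul_zero] at this
  exact sub_eq_zero.1 (norm_le_zero_iff.1 this)

theorem IsSolutionOn.continuousOn {f : E → E} {T : ℝ} {y : ℝ → E} (hy : IsSolutionOn f T y) :
    ContinuousOn y (Set.Icc 0 T) := fun t ht => (hy t ht).continuousWithinAt

theorem IsSolutionOn.shift {f : E → E} {T : ℝ} {y : ℝ → E} (hy : IsSolutionOn f T y) {t₀ h : ℝ}
    (ht₀ : 0 ≤ t₀) (hT : t₀ + h ≤ T) : IsSolutionOn f h fun t => y (t₀ + t) := by
  intro t ht
  have h1 := hy (t₀ + t) ⟨by linarith [ht.1], by linarith [ht.2]⟩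
  have h2 : HasDerivWithinAt (fun t => t₀ + t) 1 (Set.Icc 0 h) t :=
    ((hasDerivAt_id t).const_add t₀).hasDerivWithinAt
  have := h1.scomp t h2 (fun u hu => ⟨by linarith [hu.1], by linarith [hu.2]⟩)
  rwa [one_smul] at this

/-- Convergence: a method of local order `p` has global order `p`. -/
theorem HasLocalOrder.hasGlobalOrder {M : Tableau k} {f : E → E} {p : ℕ} (hp : 1 ≤ p)
    (hf : ∀ r, ∃ K : ℝ≥0, LipschitzOnWith K f (closedBall 0 r)) (hloc : HasLocalOrder M f p) :
    HasGlobalOrder M f p := by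
  intro T ρ hT hρ y hy
  obtain ⟨R₀, hR₀⟩ : ∃ R₀, ∀ t ∈ Set.Icc 0 T, ‖y t‖ ≤ R₀ :=
    isCompact_Icc.exists_bound_of_continuousOn hy.continuousOn
  have hR₀0 : 0 ≤ R₀ := (norm_nonneg _).trans (hR₀ 0 ⟨le_rfl, hT.le⟩)
  -- For small `h` the global error `C h^p` is at most `1`, so the numerical solution stays in the
  -- ball of radius `R₀ + 1`, and its stages in that of radius `R₀ + 1 + ρ`.
  obtain ⟨h₁, h₁0, C₁, H₁⟩ := hloc (R₀ + 1) ρ (by positivity) hρ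
  obtain ⟨K, hK⟩ := hf (R₀ + 1 + ρ)
  have ha0 : 0 ≤ ∑ i, ∑ j, |M.A i j| :=
    Finset.sum_nonneg fun _ _ => Finset.sum_nonneg fun _ _ => abs_nonneg _
  obtain ⟨h₂, h₂0, H₂⟩ := exists_small (a := (∑ i, ∑ j, |M.A i j|) * K) (by positivity)
    (by norm_num : (0 : ℝ) < 1 / 2)
  set L := 2 * (∑ j, |M.b j|) * (K : ℝ) with hL
  have hL0 : 0 ≤ L := by
    have : 0 ≤ ∑ j, |M.b j| := Finset.sum_nonneg fun _ _ => abs_nonneg _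
    positivity
  set C₂ := max C₁ 0 with hC₂
  have hC₂0 : 0 ≤ C₂ := le_max_right _ _
  set C := T * C₂ * Real.exp (L * T) with hC
  have hC0 : 0 ≤ C := by positivity
  obtain ⟨h₃, h₃0, H₃⟩ := exists_small hC0 one_pos
  refine ⟨min (min h₁ h₂) (min h₃ 1), by positivity, C, fun h hh m hm => ?_⟩
  have hh0 : 0 < h := hh.1
  have hh1 : h ≤ h₁ := hh.2.trans ((min_le_left _ _).trans (min_le_left _ _))
  have hs2 := H₂ h hh0 (hh.2.trans ((min_le_left _ _).trans (min_le_right _ _)))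
  have hs3 := H₃ h hh0 (hh.2.trans ((min_le_right _ _).trans (min_le_left _ _)))
  have hh4 : h ≤ 1 := hh.2.trans ((min_le_right _ _).trans (min_le_right _ _))
  have hbd : ∀ i : ℕ, i * h ≤ T → i * h * C₂ * Real.exp (L * (i * h)) * h ^ p ≤ C * h ^ p := by
    intro i hi
    rw [hC]
    gcongr
  have hle1 : C * h ^ p ≤ 1 := by
    calc C * h ^ p ≤ C * h ^ 1 := by
          gcongr ?_ * ?_
          exact pow_le_pow_of_le_one hh0.le hh4 hp
      _ ≤ 1 := by linarith
  -- Discrete Gronwall: the bound depends on the elapsed time `i h`, so the factor `1 + h L ≤ exp (L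
  -- h)` and the new local error reproduce it with `(i + 1) h`.
  have herr : ∀ m : ℕ, m * h ≤ T → ∀ z : ℕ → E, z 0 = y 0 → IsTrajectory M f ρ h m z →
      ∀ i ≤ m, ‖z i - y (i * h)‖ ≤ i * h * C₂ * Real.exp (L * (i * h)) * h ^ p := by
    intro m hm z hz0 hz i
    induction i with
    | zero => simp [hz0]
    | succ i ih =>
      intro him
      have hiT : ((i : ℝ) + 1) * h ≤ T := le_trans (by gcongr; exact_mod_cast him) hm
      have hiT' : (i : ℝ) * h ≤ T := le_trans (by gcongr; linarith) hiT
      have hi0 : 0 ≤ (i : ℝ) * h := by positivity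
      have hyi := hR₀ (i * h) ⟨hi0, hiT'⟩
      have ih' := ih (by omega)
      have hzi : ‖z i‖ ≤ R₀ + 1 := by
        have := norm_add_le (y (i * h)) (z i - y (i * h))
        rw [add_sub_cancel] at this
        linarith [hbd i hiT']
      obtain ⟨Y, hY, hzY⟩ := hz i (by omega)
      obtain ⟨⟨Z, hZ, -⟩, hZ'⟩ := H₁ (y (i * h)) (by linarith) h ⟨hh0, hh1⟩
      have hloc := hZ' Z hZ (fun t => y (i * h + t)) (hy.shift hi0 (by linarith)) (by simp)
      have hlip := norm_update_sub_le M hK hh0.le hs2 hY.1 hZ.1 (hY.norm_le hzi)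
        (hZ.norm_le (by linarith))
      rw [← hL] at hlip
      have hcast : ((i + 1 : ℕ) : ℝ) * h = i * h + h := by push_cast; ring
      rw [hzY, hcast]
      have htri := norm_add_le (update M f h (z i) Y - update M f h (y (i * h)) Z)
        (update M f h (y (i * h)) Z - y (i * h + h))
      rw [sub_add_sub_cancel] at htri
      have hC12 : C₁ * h ^ (p + 1) ≤ C₂ * h ^ (p + 1) := by
        gcongr
        exact le_max_left _ _
      have hexp : 1 + h * L ≤ Real.exp (L * h) := by linarith [Real.add_one_le_exp (L * h)]
      have hexp1 : 1 ≤ Real.exp (L * (i * h + h)) := Real.one_le_exp (by positivity)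
      calc _ ≤ _ := htri
        _ ≤ (1 + h * L) * ‖z i - y (i * h)‖ + C₂ * h ^ (p + 1) := by linarith
        _ ≤ Real.exp (L * h) * (i * h * C₂ * Real.exp (L * (i * h)) * h ^ p) +
            C₂ * h ^ (p + 1) * Real.exp (L * (i * h + h)) := by
          exact add_le_add (mul_le_mul hexp ih' (norm_nonneg _) (by positivity))
            (le_mul_of_one_le_right (by positivity) hexp1)
        _ = _ := by
          rw [mul_add, Real.exp_add]
          ring
  -- Existence relies on `herr`: the error bound keeps `z m` in the ball where the stage equations
  -- are solvable.
  have hex : ∀ m : ℕ, m * h ≤ T → ∃ z, z 0 = y 0 ∧ IsTrajectory M f ρ h m z := by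
    intro m
    induction m with
    | zero => exact fun _ => ⟨fun _ => y 0, rfl, fun i hi => absurd hi (by omega)⟩
    | succ m ih =>
      intro hm
      have hm' : (m : ℝ) * h ≤ T := le_trans (by gcongr; simp) hm
      obtain ⟨z, hz0, hz⟩ := ih hm'
      have hzm : ‖z m‖ ≤ R₀ + 1 := by
        have := norm_add_le (y (m * h)) (z m - y (m * h))
        rw [add_sub_cancel] at this
        linarith [hbd m hm', herr m hm' z hz0 hz m le_rfl, hR₀ (m * h) ⟨by positivity, hm'⟩]
      obtain ⟨⟨Y, hY, -⟩, -⟩ := H₁ (z m) hzm h ⟨hh0, hh1⟩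
      refine ⟨Function.update z (m + 1) (update M f h (z m) Y), by simp [hz0], fun i hi => ?_⟩
      rcases Nat.lt_succ_iff_lt_or_eq.1 hi with hi | rfl
      · rw [Function.update_of_ne (by omega), Function.update_of_ne (by omega)]
        exact hz i hi
      · rw [Function.update_self, Function.update_of_ne (by omega)]
        exact ⟨Y, hY, rfl⟩
  exact ⟨hex m hm, fun z hz0 hz i hi =>
    (herr m hm z hz0 hz i hi).trans (hbd i (le_trans (by gcongr) hm))⟩

end

end RungeKutta

namespace HBVM

open Polynomial Set

/-! ### The `L²` projection onto polynomials of degree less than `s` -/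

/-- The truncated Legendre expansion of `g` on `[0, 1]`. -/
noncomputable def proj (s : ℕ) (g : ℝ → ℝ) (c : ℝ) : ℝ :=
  ∑ j ∈ Finset.range s, (legendre j).eval c * ∫ t in (0 : ℝ)..1, (legendre j).eval t * g t

@[fun_prop]
theorem continuous_proj (s : ℕ) (g : ℝ → ℝ) : Continuous (proj s g) := by
  unfold proj
  fun_prop

theorem proj_eval (s : ℕ) (q : ℝ[X]) (hq : q.degree < s) (c : ℝ) :
    proj s (fun t => q.eval t) c = q.eval c := by
  conv_rhs => rw [← sum_legendre_expansion s q hq]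
  simp [proj, eval_finsetSum, mul_comm]

theorem proj_sub (s : ℕ) {g₁ g₂ : ℝ → ℝ} (h₁ : Continuous g₁) (h₂ : Continuous g₂) (c : ℝ) :
    proj s (fun t => g₁ t - g₂ t) c = proj s g₁ c - proj s g₂ c := by
  simp only [proj, mul_sub, ← Finset.sum_sub_distrib]
  refine Finset.sum_congr rfl fun j _ => ?_
  rw [intervalIntegral.integral_sub (Continuous.intervalIntegrable (by fun_prop) _ _)
    (Continuous.intervalIntegrable (by fun_prop) _ _), mul_sub]

theorem exists_bound_eval (q : ℝ[X]) : ∃ B, 0 ≤ B ∧ ∀ c ∈ Icc (0 : ℝ) 1, |q.eval c| ≤ B := by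
  obtain ⟨B, hB⟩ := isCompact_Icc.exists_bound_of_continuousOn (s := Icc (0 : ℝ) 1)
    (f := fun c => q.eval c) q.continuous.continuousOn
  exact ⟨B, (norm_nonneg _).trans (hB 0 ⟨le_rfl, zero_le_one⟩), hB⟩

theorem abs_integral_le {g : ℝ → ℝ} {B c d : ℝ} (hB : ∀ t ∈ Icc (0 : ℝ) 1, |g t| ≤ B)
    (hc : c ∈ Icc (0 : ℝ) 1) (hd : d ∈ Icc (0 : ℝ) 1) : |∫ t in c..d, g t| ≤ B := by
  have hB0 : 0 ≤ B := (abs_nonneg _).trans (hB 0 ⟨le_rfl, zero_le_one⟩)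
  have h := intervalIntegral.norm_integral_le_of_norm_le_const (a := c) (b := d) (f := g) (C := B)
    fun t ht => hB t ((uIcc_subset_Icc hc hd) (uIoc_subset_uIcc ht))
  refine h.trans (mul_le_of_le_one_right hB0 ?_)
  rw [abs_le]
  constructor <;> linarith [hc.1, hc.2, hd.1, hd.2]

theorem exists_bound_proj (s : ℕ) : ∃ K, 0 ≤ K ∧ ∀ (g : ℝ → ℝ) (B : ℝ),
    (∀ t ∈ Icc (0 : ℝ) 1, |g t| ≤ B) → ∀ c ∈ Icc (0 : ℝ) 1, |proj s g c| ≤ K * B := by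
  choose M hM0 hM using fun j => exists_bound_eval (legendre j)
  refine ⟨∑ j ∈ Finset.range s, M j * M j, Finset.sum_nonneg fun j _ => mul_nonneg (hM0 j) (hM0 j),
    fun g B hB c hc => ?_⟩
  rw [proj, Finset.sum_mul]
  refine (Finset.abs_sum_le_sum_abs _ _).trans (Finset.sum_le_sum fun j _ => ?_)
  rw [abs_mul, mul_assoc]
  refine mul_le_mul (hM j c hc) (abs_integral_le (fun t ht => ?_) ⟨le_rfl, zero_le_one⟩
    ⟨zero_le_one, le_rfl⟩) (abs_nonneg _) (hM0 j)
  rw [abs_mul]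
  exact mul_le_mul (hM j t ht) (hB t ht) (abs_nonneg _) (hM0 j)

/-- The projection is self-adjoint and reproduces `q`: expanding `q` in Legendre polynomials turns
`∫ q g` into the same double sum as `∫ q Πg`. -/
theorem integral_eval_mul_proj_sub (s : ℕ) (q : ℝ[X]) (hq : q.degree < s) {g : ℝ → ℝ}
    (hg : Continuous g) : ∫ c in (0 : ℝ)..1, q.eval c * (proj s g c - g c) = 0 := by
  have h1 : ∫ c in (0 : ℝ)..1, q.eval c * proj s g c = ∫ c in (0 : ℝ)..1, q.eval c * g c := by
    have e1 : ∀ c, q.eval c * proj s g c = ∑ j ∈ Finset.range s,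
        ((legendre j).eval c * q.eval c) * ∫ t in (0 : ℝ)..1, (legendre j).eval t * g t := by
      intro c
      rw [proj, Finset.mul_sum]
      exact Finset.sum_congr rfl fun j _ => by ring
    have e2 : ∀ c, q.eval c * g c = ∑ j ∈ Finset.range s,
        (∫ t in (0 : ℝ)..1, (legendre j).eval t * q.eval t) * ((legendre j).eval c * g c) := by
      intro c
      conv_lhs => rw [← proj_eval s q hq, proj, Finset.sum_mul]
      exact Finset.sum_congr rfl fun j _ => by ring
    simp_rw [e1, e2]
    rw [intervalIntegral.integral_finsetSum
        fun j _ => Continuous.intervalIntegrable (by fun_prop) _ _,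
      intervalIntegral.integral_finsetSum
        fun j _ => Continuous.intervalIntegrable (by fun_prop) _ _]
    simp_rw [intervalIntegral.integral_mul_const, intervalIntegral.integral_const_mul]
  simp_rw [mul_sub]
  rw [intervalIntegral.integral_sub (Continuous.intervalIntegrable (by fun_prop) _ _)
    (Continuous.intervalIntegrable (by fun_prop) _ _), h1, sub_self]

/-! ### Families of functions of size `O(h ^ m)` -/

variable {P : Type*} {h : P → ℝ}

/-- `g p c = O(h p ^ m)` uniformly in the parameter `p` and in `c ∈ [0, 1]`. -/
def UniformO (h : P → ℝ) (m : ℕ) (g : P → ℝ → ℝ) : Prop :=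
  ∃ C, 0 ≤ C ∧ ∀ p, ∀ c ∈ Icc (0 : ℝ) 1, |g p c| ≤ C * h p ^ m

namespace UniformO

theorem congr {m : ℕ} {g g' : P → ℝ → ℝ} (hg : UniformO h m g)
    (e : ∀ p, ∀ c ∈ Icc (0 : ℝ) 1, g' p c = g p c) : UniformO h m g' := by
  obtain ⟨C, hC, H⟩ := hg
  exact ⟨C, hC, fun p c hc => by rw [e p c hc]; exact H p c hc⟩

theorem add {m : ℕ} {g g' : P → ℝ → ℝ} (hg : UniformO h m g) (hg' : UniformO h m g') :
    UniformO h m fun p c => g p c + g' p c := by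
  obtain ⟨C, hC, H⟩ := hg
  obtain ⟨C', hC', H'⟩ := hg'
  refine ⟨C + C', by positivity, fun p c hc => (abs_add_le _ _).trans ?_⟩
  rw [add_mul]
  exact add_le_add (H p c hc) (H' p c hc)

theorem neg {m : ℕ} {g : P → ℝ → ℝ} (hg : UniformO h m g) : UniformO h m fun p c => -g p c := by
  obtain ⟨C, hC, H⟩ := hg
  exact ⟨C, hC, fun p c hc => by rw [abs_neg]; exact H p c hc⟩

theorem sub {m : ℕ} {g g' : P → ℝ → ℝ} (hg : UniformO h m g) (hg' : UniformO h m g') :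
    UniformO h m fun p c => g p c - g' p c := by
  simpa [sub_eq_add_neg] using hg.add hg'.neg

theorem sum {ι : Type*} (S : Finset ι) {m : ℕ} {g : ι → P → ℝ → ℝ}
    (hg : ∀ i ∈ S, UniformO h m (g i)) : UniformO h m fun p c => ∑ i ∈ S, g i p c := by
  classical
  induction S using Finset.induction_on with
  | empty => exact ⟨0, le_rfl, fun p c _ => by simp⟩
  | insert i S hi ih =>
    refine ((hg i (Finset.mem_insert_self i S)).add
      (ih fun j hj => hg j (Finset.mem_insert_of_mem hj))).congr fun p c _ => ?_
    rw [Finset.sum_insert hi]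

theorem mul (hh : ∀ p, 0 < h p) {m m' : ℕ} {g g' : P → ℝ → ℝ} (hg : UniformO h m g)
    (hg' : UniformO h m' g') : UniformO h (m + m') fun p c => g p c * g' p c := by
  obtain ⟨C, hC, H⟩ := hg
  obtain ⟨C', hC', H'⟩ := hg'
  refine ⟨C * C', by positivity, fun p c hc => ?_⟩
  have := (hh p).le
  rw [abs_mul]
  calc _ ≤ (C * h p ^ m) * (C' * h p ^ m') :=
        mul_le_mul (H p c hc) (H' p c hc) (abs_nonneg _) (by positivity)
    _ = _ := by ring

theorem integral {m : ℕ} {g : P → ℝ → ℝ} (hg : UniformO h m g) {a b : P → ℝ → ℝ}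
    (ha : ∀ p, ∀ c ∈ Icc (0 : ℝ) 1, a p c ∈ Icc (0 : ℝ) 1)
    (hb : ∀ p, ∀ c ∈ Icc (0 : ℝ) 1, b p c ∈ Icc (0 : ℝ) 1) :
    UniformO h m fun p c => ∫ t in a p c..b p c, g p t := by
  obtain ⟨C, hC, H⟩ := hg
  exact ⟨C, hC, fun p c hc => abs_integral_le (H p) (ha p c hc) (hb p c hc)⟩

theorem step (hh : ∀ p, 0 < h p) {m : ℕ} {g : P → ℝ → ℝ} (hg : UniformO h m g) :
    UniformO h (m + 1) fun p c => h p * g p c := by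
  obtain ⟨C, hC, H⟩ := hg
  refine ⟨C, hC, fun p c hc => ?_⟩
  rw [abs_mul, abs_of_pos (hh p), pow_succ]
  have := mul_le_mul_of_nonneg_left (H p c hc) (hh p).le
  linarith

theorem mono (hh : ∀ p, 0 < h p) (hh1 : ∀ p, h p ≤ 1) {m m' : ℕ} (hm : m ≤ m') {g : P → ℝ → ℝ}
    (hg : UniformO h m' g) : UniformO h m g := by
  obtain ⟨C, hC, H⟩ := hg
  refine ⟨C, hC, fun p c hc => (H p c hc).trans ?_⟩
  gcongr ?_ * ?_
  exact pow_le_pow_of_le_one (hh p).le (hh1 p) hm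

end UniformO

/-! ### Families with Taylor expansions in `h c` -/

/-- Up to `O(h ^ m)`, the functions `g p` are polynomials in `h p * c` with bounded degrees and
bounded coefficients. -/
def Expandable (h : P → ℝ) (m : ℕ) (g : P → ℝ → ℝ) : Prop :=
  (∀ p, Continuous (g p)) ∧ ∃ (D : ℕ) (C : ℝ) (q : P → ℝ[X]), 0 ≤ C ∧
    (∀ p, (q p).natDegree ≤ D) ∧ (∀ p j, |(q p).coeff j| ≤ C) ∧
    UniformO h m fun p c => g p c - (q p).eval (h p * c)

theorem abs_eval_le {q : ℝ[X]} {D : ℕ} {C t : ℝ} (hD : q.natDegree ≤ D)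
    (hC : ∀ j, |q.coeff j| ≤ C) (ht : |t| ≤ 1) : |q.eval t| ≤ (D + 1) * C := by
  rw [eval_eq_sum_range' (Nat.lt_succ_of_le hD)]
  refine (Finset.abs_sum_le_sum_abs _ _).trans ?_
  calc _ ≤ ∑ _j ∈ Finset.range (D + 1), C := by
        refine Finset.sum_le_sum fun j _ => ?_
        rw [abs_mul, abs_pow]
        exact (mul_le_of_le_one_right (abs_nonneg _) (pow_le_one₀ (abs_nonneg _) ht)).trans (hC j)
    _ = _ := by simp

theorem abs_mul_le_one {a c : ℝ} (h0 : 0 < a) (h1 : a ≤ 1) (hc : c ∈ Icc (0 : ℝ) 1) :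
    |a * c| ≤ 1 := by
  rw [abs_of_nonneg (mul_nonneg h0.le hc.1)]
  exact mul_le_one₀ h1 hc.1 hc.2

namespace Expandable

theorem continuous {m : ℕ} {g : P → ℝ → ℝ} (hg : Expandable h m g) (p : P) : Continuous (g p) :=
  hg.1 p

theorem congr {m : ℕ} {g g' : P → ℝ → ℝ} (hg : Expandable h m g) (hg' : ∀ p, Continuous (g' p))
    (e : ∀ p, ∀ c ∈ Icc (0 : ℝ) 1, g' p c = g p c) : Expandable h m g' := by
  obtain ⟨-, D, C, q, hC, hD, hq, H⟩ := hg
  exact ⟨hg', D, C, q, hC, hD, hq, H.congr fun p c hc => by rw [e p c hc]⟩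

theorem mono (hh : ∀ p, 0 < h p) (hh1 : ∀ p, h p ≤ 1) {m m' : ℕ} (hm : m ≤ m') {g : P → ℝ → ℝ}
    (hg : Expandable h m' g) : Expandable h m g := by
  obtain ⟨hc, D, C, q, hC, hD, hq, H⟩ := hg
  exact ⟨hc, D, C, q, hC, hD, hq, H.mono hh hh1 hm⟩

theorem uniformO_zero (hh : ∀ p, 0 < h p) (hh1 : ∀ p, h p ≤ 1) {m : ℕ} {g : P → ℝ → ℝ}
    (hg : Expandable h m g) : UniformO h 0 g := by
  obtain ⟨hc, D, C, q, hC, hD, hq, H⟩ := hg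
  have h2 : UniformO h 0 fun p c => (q p).eval (h p * c) :=
    ⟨(D + 1) * C, by positivity, fun p c hc => by
      simpa using abs_eval_le (hD p) (hq p) (abs_mul_le_one (hh p) (hh1 p) hc)⟩
  exact ((H.mono hh hh1 (Nat.zero_le m)).add h2).congr fun p c _ => by ring

theorem zero_iff {g : P → ℝ → ℝ} (hc : ∀ p, Continuous (g p)) (hg : UniformO h 0 g) :
    Expandable h 0 g :=
  ⟨hc, 0, 0, 0, le_rfl, by simp, by simp, by simpa using hg⟩

theorem const (m : ℕ) {k : P → ℝ} {B : ℝ} (hk : ∀ p, |k p| ≤ B) (hB : 0 ≤ B) :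
    Expandable h m fun p _ => k p := by
  refine ⟨fun p => continuous_const, 0, B, fun p => C (k p), hB, by simp, fun p j => ?_,
    ⟨0, le_rfl, by simp⟩⟩
  rw [coeff_C]
  split_ifs
  · exact hk p
  · simpa using hB

theorem add {m : ℕ} {g g' : P → ℝ → ℝ} (hg : Expandable h m g) (hg' : Expandable h m g') :
    Expandable h m fun p c => g p c + g' p c := by
  obtain ⟨hc, D, C, q, hC, hD, hq, H⟩ := hg
  obtain ⟨hc', D', C', q', hC', hD', hq', H'⟩ := hg'
  refine ⟨fun p => (hc p).add (hc' p), max D D', C + C', fun p => q p + q' p, by positivity,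
    fun p => (natDegree_add_le _ _).trans (max_le_max (hD p) (hD' p)), fun p j => ?_,
    (H.add H').congr fun p c _ => ?_⟩
  · rw [coeff_add]
    exact (abs_add_le _ _).trans (add_le_add (hq p j) (hq' p j))
  · rw [eval_add]
    ring

theorem mul (hh : ∀ p, 0 < h p) (hh1 : ∀ p, h p ≤ 1) {m : ℕ} {g g' : P → ℝ → ℝ}
    (hg : Expandable h m g) (hg' : Expandable h m g') :
    Expandable h m fun p c => g p c * g' p c := by
  have hb := hg.uniformO_zero hh hh1
  obtain ⟨hc, D, C, q, hC, hD, hq, H⟩ := hg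
  obtain ⟨hc', D', C', q', hC', hD', hq', H'⟩ := hg'
  have h2 : UniformO h 0 fun p c => (q' p).eval (h p * c) :=
    ⟨(D' + 1) * C', by positivity, fun p c hc => by
      simpa using abs_eval_le (hD' p) (hq' p) (abs_mul_le_one (hh p) (hh1 p) hc)⟩
  refine ⟨fun p => (hc p).mul (hc' p), D + D', (D + D' + 1) * (C * C'), fun p => q p * q' p,
    by positivity, fun p => natDegree_mul_le.trans (add_le_add (hD p) (hD' p)), fun p j => ?_, ?_⟩
  · rcases lt_or_ge (D + D') j with hj | hj
    · rw [coeff_eq_zero_of_natDegree_lt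
        ((natDegree_mul_le.trans (add_le_add (hD p) (hD' p))).trans_lt hj)]
      simp only [abs_zero]
      positivity
    · rw [coeff_mul]
      refine (Finset.abs_sum_le_sum_abs _ _).trans ?_
      calc _ ≤ ∑ _x ∈ Finset.HasAntidiagonal.antidiagonal j, C * C' := by
            refine Finset.sum_le_sum fun x _ => ?_
            rw [abs_mul]
            exact mul_le_mul (hq p _) (hq' p _) (abs_nonneg _) hC
        _ = (j + 1) * (C * C') := by simp
        _ ≤ _ := by
            gcongr
            exact_mod_cast hj
  · have h3 := hb.mul hh H'
    have h4 := h2.mul hh H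
    rw [zero_add] at h3 h4
    refine (h3.add h4).congr fun p c _ => ?_
    rw [eval_mul]
    ring

theorem eval_mvPolynomial (hh : ∀ p, 0 < h p) (hh1 : ∀ p, h p ≤ 1) {κ : Type*} {m : ℕ}
    {u : κ → P → ℝ → ℝ} (hu : ∀ i, Expandable h m (u i)) (F : MvPolynomial κ ℝ) :
    Expandable h m fun p c => MvPolynomial.eval (fun i => u i p c) F := by
  induction F using MvPolynomial.induction_on with
  | C a =>
    simpa using const (h := h) m (k := fun _ => a) (fun _ => le_rfl) (abs_nonneg a)
  | add F G hF hG => simpa using hF.add hG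
  | mul_X F i hF => simpa using hF.mul hh hh1 (hu i)

/-- Polynomial maps satisfy `F u - F v = ∑ A j (u j - v j)` with expandable divided differences. -/
theorem exists_sub_eq_sum (hh : ∀ p, 0 < h p) (hh1 : ∀ p, h p ≤ 1) {κ : Type*} [Fintype κ] {m : ℕ}
    {u v : κ → P → ℝ → ℝ} (hu : ∀ i, Expandable h m (u i)) (hv : ∀ i, Expandable h m (v i))
    (F : MvPolynomial κ ℝ) : ∃ A : κ → P → ℝ → ℝ, (∀ j, Expandable h m (A j)) ∧ ∀ p c,
      MvPolynomial.eval (fun i => u i p c) F - MvPolynomial.eval (fun i => v i p c) F =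
        ∑ j, A j p c * (u j p c - v j p c) := by
  classical
  have hconst : ∀ a : ℝ, Expandable h m fun _ _ => a := fun a =>
    const (h := h) m (k := fun _ => a) (fun _ => le_rfl) (abs_nonneg a)
  induction F using MvPolynomial.induction_on with
  | C a => exact ⟨fun _ _ _ => 0, fun _ => hconst 0, fun p c => by simp⟩
  | add F G hF hG =>
    obtain ⟨A, hA, eA⟩ := hF
    obtain ⟨B, hB, eB⟩ := hG
    refine ⟨fun j p c => A j p c + B j p c, fun j => (hA j).add (hB j), fun p c => ?_⟩
    simp only [map_add, add_mul, Finset.sum_add_distrib, ← eA, ← eB]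
    ring
  | mul_X F i hF =>
    obtain ⟨A, hA, eA⟩ := hF
    -- From `F(u) uᵢ - F(v) vᵢ = (F(u) - F(v)) uᵢ + F(v) (uᵢ - vᵢ)`.
    refine ⟨fun j p c => A j p c * u i p c +
      (if j = i then 1 else 0) * MvPolynomial.eval (fun i => v i p c) F, fun j =>
        ((hA j).mul hh hh1 (hu i)).add ((hconst _).mul hh hh1 (eval_mvPolynomial hh hh1 hv F)),
        fun p c => ?_⟩
    have e : ∀ j, (A j p c * u i p c +
        (if j = i then 1 else 0) * MvPolynomial.eval (fun i => v i p c) F) *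
          (u j p c - v j p c) = A j p c * (u j p c - v j p c) * u i p c +
          if j = i then MvPolynomial.eval (fun i => v i p c) F * (u j p c - v j p c) else 0 := by
      intro j
      split_ifs <;> ring
    simp only [map_mul, MvPolynomial.eval_X, e, Finset.sum_add_distrib, ← Finset.sum_mul, ← eA,
      Finset.sum_ite_eq', Finset.mem_univ, if_true]
    ring

/-- The approximating polynomials may be chosen of degree less than `m`. -/
theorem exists_truncation (hh : ∀ p, 0 < h p) (hh1 : ∀ p, h p ≤ 1) {m : ℕ} {g : P → ℝ → ℝ}
    (hg : Expandable h m g) : ∃ (C : ℝ) (q : P → ℝ[X]), 0 ≤ C ∧ (∀ p, (q p).degree < m) ∧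
      (∀ p j, |(q p).coeff j| ≤ C) ∧ UniformO h m fun p c => g p c - (q p).eval (h p * c) := by
  obtain ⟨hc, D, C, q, hC, hD, hq, H⟩ := hg
  refine ⟨C, fun p => ∑ j ∈ Finset.range m, monomial j ((q p).coeff j), hC, fun p => ?_,
    fun p j => ?_, ?_⟩
  · rw [degree_lt_iff_coeff_zero]
    intro k hk
    rw [finsetSum_coeff]
    refine Finset.sum_eq_zero fun j hj => ?_
    rw [coeff_monomial, if_neg]
    rw [Finset.mem_range] at hj
    omega
  · simp only [finsetSum_coeff, coeff_monomial, Finset.sum_ite_eq', Finset.mem_range]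
    split_ifs
    · exact hq p j
    · simpa using hC
  · have h2 : UniformO h m fun p c => ∑ x ∈ Finset.range (D + 1),
        (q p).coeff (m + x) * (h p * c) ^ (m + x) := by
      refine UniformO.sum _ fun x _ => ⟨C, hC, fun p c hc => ?_⟩
      rw [abs_mul, abs_pow]
      refine mul_le_mul (hq p _) ?_ (by positivity) hC
      rw [abs_of_nonneg (mul_nonneg (hh p).le hc.1)]
      calc (h p * c) ^ (m + x) ≤ (h p * c) ^ m :=
            pow_le_pow_of_le_one (mul_nonneg (hh p).le hc.1)
              (mul_le_one₀ (hh1 p) hc.1 hc.2) (by omega)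
        _ ≤ h p ^ m := pow_le_pow_left₀ (mul_nonneg (hh p).le hc.1)
              (mul_le_of_le_one_right (hh p).le hc.2) m
    refine (H.add h2).congr fun p c _ => ?_
    rw [eval_eq_sum_range' (p := q p) (n := m + (D + 1)) (by have := hD p; omega), Finset.sum_range_add,
      eval_finsetSum]
    simp only [eval_monomial]
    ring

/-- Integration gains one order. -/
theorem integral {m : ℕ} (hh : ∀ p, 0 < h p) {g : P → ℝ → ℝ} (hg : Expandable h m g) :
    Expandable h (m + 1) fun p c => h p * ∫ t in (0 : ℝ)..c, g p t := by
  obtain ⟨hc, D, C, q, hC, hD, hq, H⟩ := hg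
  have hcont : ∀ p, Continuous fun c => h p * ∫ t in (0 : ℝ)..c, g p t := fun p =>
    continuous_const.mul
      (intervalIntegral.continuous_primitive (fun a b => (hc p).intervalIntegrable a b) 0)
  -- The outer factor `h` turns `∫₀^c (h t)^j dt` into `(h c)^(j+1) / (j+1)`, again a monomial in `h
  -- c`; dividing by `j + 1` does not enlarge the coefficients.
  have hcoeff : ∀ p k, (∑ j ∈ Finset.range (D + 1),
      monomial (j + 1) ((q p).coeff j / (j + 1)) : ℝ[X]).coeff k =
        if k = 0 then 0 else if k < D + 2 then (q p).coeff (k - 1) / k else 0 := by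
    intro p k
    rcases k with _ | k
    · simp [coeff_monomial]
    · simp [coeff_monomial]
  refine ⟨hcont, D + 1, C, fun p => ∑ j ∈ Finset.range (D + 1),
    monomial (j + 1) ((q p).coeff j / (j + 1)), hC, fun p => ?_, fun p k => ?_, ?_⟩
  · rw [natDegree_le_iff_coeff_eq_zero]
    intro k hk
    rw [hcoeff, if_neg (by omega), if_neg (by omega)]
  · rw [hcoeff]
    split_ifs with h1 h2
    · simpa using hC
    · rw [abs_div, Nat.abs_cast]
      refine (div_le_self (abs_nonneg _) ?_).trans (hq p _)
      exact_mod_cast Nat.one_le_iff_ne_zero.2 h1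
    · simpa using hC
  · have h2 := (H.integral (a := fun _ _ => 0) (b := fun _ c => c)
      (fun _ _ _ => ⟨le_rfl, zero_le_one⟩) fun _ _ hc => hc).step hh
    refine h2.congr fun p c _ => ?_
    have e1 : ∫ t in (0 : ℝ)..c, (q p).eval (h p * t) = ∑ j ∈ Finset.range (D + 1),
        (q p).coeff j * h p ^ j * (c ^ (j + 1) / (j + 1)) := by
      simp_rw [fun t => eval_eq_sum_range' (Nat.lt_succ_of_le (hD p)) (h p * t), mul_pow,
        ← mul_assoc]
      rw [intervalIntegral.integral_finsetSum
        fun i _ => Continuous.intervalIntegrable (by fun_prop) _ _]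
      simp [intervalIntegral.integral_const_mul, integral_pow]
    rw [intervalIntegral.integral_sub ((hc p).intervalIntegrable _ _)
      (Continuous.intervalIntegrable (by fun_prop) _ _), e1, mul_sub, eval_finsetSum,
      Finset.mul_sum]
    congr 1
    refine Finset.sum_congr rfl fun j _ => ?_
    rw [eval_monomial]
    ring

/-- The tail is a bounded constant minus the primitive from `0`. Such tails are the weights produced
by integration by parts in `uniformO_endpoint`. -/
theorem integral_one (hh : ∀ p, 0 < h p) (hh1 : ∀ p, h p ≤ 1) {m : ℕ} {g : P → ℝ → ℝ}
    (hg : Expandable h m g) : Expandable h (m + 1) fun p c => h p * ∫ t in c..(1 : ℝ), g p t := by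
  have hb := hg.uniformO_zero hh hh1
  obtain ⟨C, hC, H⟩ := (hb.integral (a := fun _ _ => 0) (b := fun _ _ => 1)
      (fun _ _ _ => ⟨le_rfl, zero_le_one⟩) fun _ _ _ => ⟨zero_le_one, le_rfl⟩).step hh
  have h1 : Expandable h (m + 1) fun p _ => h p * ∫ t in (0 : ℝ)..1, g p t :=
    const _ (B := C) (fun p => (H p 0 ⟨le_rfl, zero_le_one⟩).trans
      (mul_le_of_le_one_right hC (pow_le_one₀ (hh p).le (hh1 p)))) hC
  have h2 : Expandable h (m + 1) fun _ _ => (-1 : ℝ) :=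
    const _ (k := fun _ => (-1 : ℝ)) (fun _ => le_rfl) (abs_nonneg _)
  have e : ∀ p c, h p * ∫ t in c..(1 : ℝ), g p t =
      h p * (∫ t in (0 : ℝ)..1, g p t) + (-1) * (h p * ∫ t in (0 : ℝ)..c, g p t) := by
    intro p c
    rw [← intervalIntegral.integral_add_adjacent_intervals
      ((hg.1 p).intervalIntegrable 0 c) ((hg.1 p).intervalIntegrable c 1)]
    ring
  rw [funext fun p => funext (e p)]
  exact h1.add (h2.mul hh hh1 (hg.integral hh))

theorem degree_comp_lt {q : ℝ[X]} {m : ℕ} (hq : q.degree < m) (a : ℝ) :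
    (q.comp (C a * X)).degree < m := by
  rw [degree_lt_iff_coeff_zero] at hq ⊢
  intro k hk
  rw [comp_C_mul_X_coeff, hq k hk, zero_mul]

/-- With `q` the truncation of degree below `m ≤ s`, `Πq = q`, so `Πg - g = Π(g - q) - (g - q)`, and
`Π` is bounded in the supremum norm. -/
theorem proj_sub_self (hh : ∀ p, 0 < h p) (hh1 : ∀ p, h p ≤ 1) {m s : ℕ} (hm : m ≤ s)
    {g : P → ℝ → ℝ} (hg : Expandable h m g) : UniformO h m fun p c => proj s (g p) c - g p c := by
  obtain ⟨C, q, hC, hD, hq, H⟩ := hg.exists_truncation hh hh1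
  obtain ⟨K, hK, HK⟩ := exists_bound_proj s
  have h2 : UniformO h m fun p c => proj s (fun t => g p t - (q p).eval (h p * t)) c := by
    obtain ⟨B, hB, H'⟩ := H
    refine ⟨K * B, by positivity, fun p c hc => ?_⟩
    rw [mul_assoc]
    exact HK _ _ (H' p) c hc
  refine (h2.sub H).congr fun p c _ => ?_
  rw [proj_sub s (hg.1 p) (by fun_prop)]
  have e := proj_eval s ((q p).comp (Polynomial.C (h p) * X))
    ((degree_comp_lt (hD p) _).trans_le (by exact_mod_cast hm)) c
  simp only [eval_comp, eval_mul, eval_C, eval_X] at e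
  rw [e]
  ring

theorem proj (hh : ∀ p, 0 < h p) (hh1 : ∀ p, h p ≤ 1) {m s : ℕ} (hm : m ≤ s)
    {g : P → ℝ → ℝ} (hg : Expandable h m g) : Expandable h m fun p => HBVM.proj s (g p) := by
  have h1 := hg.proj_sub_self hh hh1 hm
  obtain ⟨hc, D, C, q, hC, hD, hq, H⟩ := hg
  refine ⟨fun p => continuous_proj s _, D, C, q, hC, hD, hq, (h1.add H).congr fun p c _ => ?_⟩
  ring

/-- The projection error is orthogonal to expandable families up to `O(h ^ (2 s))`. -/
theorem integral_mul_proj_sub (hh : ∀ p, 0 < h p) (hh1 : ∀ p, h p ≤ 1) {s : ℕ}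
    {G g : P → ℝ → ℝ} (hG : Expandable h s G) (hg : Expandable h s g) :
    UniformO h (2 * s) fun p _ => ∫ t in (0 : ℝ)..1, G p t * (HBVM.proj s (g p) t - g p t) := by
  have hr := hg.proj_sub_self hh hh1 le_rfl
  -- The truncation of `G` is orthogonal to the projection error; what remains is a product of two
  -- terms of size `O(h^s)`.
  obtain ⟨C, q, hC, hD, hq, H⟩ := hG.exists_truncation hh hh1
  have h2 := (H.mul hh hr).integral (a := fun _ _ => 0) (b := fun _ _ => 1)
      (fun _ _ _ => ⟨le_rfl, zero_le_one⟩) fun _ _ _ => ⟨zero_le_one, le_rfl⟩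
  rw [← two_mul] at h2
  refine h2.congr fun p c _ => ?_
  have e := integral_eval_mul_proj_sub s ((q p).comp (Polynomial.C (h p) * X))
    (degree_comp_lt (hD p) _) (hg.1 p)
  simp only [eval_comp, eval_mul, eval_C, eval_X] at e
  have := hG.1 p
  have := hg.1 p
  simp_rw [sub_mul (G p _)]
  rw [intervalIntegral.integral_sub (Continuous.intervalIntegrable (by fun_prop) _ _)
    (Continuous.intervalIntegrable (by fun_prop) _ _), e, sub_zero]

end Expandable

end HBVM

/-! ### Superconvergence at the endpoint for projected integral equations. -/

namespace HBVM

open Polynomial Set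

section

variable {P : Type*} {h : P → ℝ} {κ : Type*}

/-- Solutions of integral equations are expandable, by Picard iteration. -/
theorem Expandable.of_integral_eq (hh : ∀ p, 0 < h p) {s : ℕ} {u g : κ → P → ℝ → ℝ}
    (hu : ∀ i p, Continuous (u i p)) (hb : ∀ i, UniformO h 0 (u i))
    (hg : ∀ m < s, (∀ i, Expandable h m (u i)) → ∀ i, Expandable h m (g i))
    (e : ∀ i p, ∀ c ∈ Icc (0 : ℝ) 1, u i p c = u i p 0 + h p * ∫ t in (0 : ℝ)..c, g i p t) :
    ∀ m ≤ s, ∀ i, Expandable h m (u i) := by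
  intro m
  induction m with
  | zero => exact fun _ i => Expandable.zero_iff (hu i) (hb i)
  | succ m ih =>
    intro hm i
    obtain ⟨C, hC, H⟩ := hb i
    have h1 : Expandable h (m + 1) fun p _ => u i p 0 :=
      Expandable.const _ (fun p => by simpa using H p 0 ⟨le_rfl, zero_le_one⟩) hC
    exact (h1.add ((hg m hm (ih (by omega)) i).integral hh)).congr (hu i) (e i)

/-- Integration by parts with vanishing boundary terms; it moves the primitive from the error to the
weight. -/
theorem integral_tail_mul {G ψ : ℝ → ℝ} (hG : Continuous G) (hψ : Continuous ψ) :
    ∫ t in (0 : ℝ)..1, G t * ∫ x in (0 : ℝ)..t, ψ x =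
      ∫ t in (0 : ℝ)..1, (∫ x in t..(1 : ℝ), G x) * ψ t := by
  have h1 : ∀ t, HasDerivAt (fun t => ∫ x in t..(1 : ℝ), G x) (-G t) t := fun t =>
    intervalIntegral.integral_hasDerivAt_left (hG.intervalIntegrable _ _)
      (hG.stronglyMeasurableAtFilter _ _) hG.continuousAt
  have h2 : ∀ t, HasDerivAt (fun t => ∫ x in (0 : ℝ)..t, ψ x) (ψ t) t := fun t =>
    intervalIntegral.integral_hasDerivAt_right (hψ.intervalIntegrable _ _)
      (hψ.stronglyMeasurableAtFilter _ _) hψ.continuousAt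
  have := intervalIntegral.integral_mul_deriv_eq_deriv_mul (a := 0) (b := 1)
    (fun t _ => h1 t) (fun t _ => h2 t) (hG.neg.intervalIntegrable _ _)
    (hψ.intervalIntegrable _ _)
  rw [this]
  simp

/-- Superconvergence: if `e = h ∫ (A e + r)` with expandable `A` and `r` a projection error, then
`e 1 = O(h ^ (2 s + 1))`. -/
theorem uniformO_endpoint [Fintype κ] (hh : ∀ p, 0 < h p) (hh1 : ∀ p, h p ≤ 1) {s : ℕ}
    {e g : κ → P → ℝ → ℝ} {A : κ → κ → P → ℝ → ℝ} (he : ∀ i p, Continuous (e i p))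
    (hb : ∀ i, UniformO h 0 (e i)) (hA : ∀ i j, Expandable h s (A i j))
    (hg : ∀ i, Expandable h s (g i))
    (eq : ∀ i p, ∀ c ∈ Icc (0 : ℝ) 1, e i p c = h p * ∫ t in (0 : ℝ)..c,
      (∑ j, A i j p t * e j p t + (proj s (g i p) t - g i p t))) (i : κ) (hs : 1 ≤ s) :
    UniformO h (2 * s + 1) fun p _ => e i p 1 := by
  have hA0 : ∀ i j, UniformO h 0 (A i j) := fun i j => (hA i j).uniformO_zero hh hh1
  have hAc : ∀ i j p, Continuous (A i j p) := fun i j p => (hA i j).continuous p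
  have hgc : ∀ i p, Continuous (g i p) := fun i p => (hg i).continuous p
  have hr : ∀ i, UniformO h s fun p c => proj s (g i p) c - g i p c := fun i =>
    (hg i).proj_sub_self hh hh1 le_rfl
  -- Each pass through the integral equation gains a factor `h`, up to the size `h^s` of the
  -- projection error.
  have hsmall : ∀ m ≤ s, ∀ i, UniformO h m (e i) := by
    intro m
    induction m with
    | zero => exact fun _ => hb
    | succ m ih =>
      intro hm i
      have h1 : UniformO h m fun p t => ∑ j, A i j p t * e j p t := UniformO.sum _ fun j _ => by
        simpa using (hA0 i j).mul hh (ih (by omega) j)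
      exact (((h1.add ((hr i).mono hh hh1 (by omega))).integral (a := fun _ _ => 0)
        (b := fun _ c => c) (fun _ _ _ => ⟨le_rfl, zero_le_one⟩) fun _ _ hc => hc).step hh).congr
        (eq i)
  -- Descending induction on the order `l` of the weight `G`. Substituting the equation for `e`
  -- replaces `G` by the weights `(h ∫_t^1 G) A i j`, of order `l + 1`, plus an integral against the
  -- projection error, which is `O(h^(2s))`. At `l = s` the sizes of `G` and `e` multiply to
  -- `h^(2s)`.
  have key : ∀ n l, l + n = s → ∀ i (G : P → ℝ → ℝ), Expandable h s G → UniformO h l G →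
      UniformO h (2 * s) fun p _ => ∫ t in (0 : ℝ)..1, G p t * e i p t := by
    intro n
    induction n with
    | zero =>
      intro l hl i G _ hG
      obtain rfl : l = s := hl
      rw [two_mul]
      exact (hG.mul hh (hsmall l le_rfl i)).integral (a := fun _ _ => 0) (b := fun _ _ => 1)
        (fun _ _ _ => ⟨le_rfl, zero_le_one⟩) fun _ _ _ => ⟨zero_le_one, le_rfl⟩
    | succ n ih =>
      intro l hl i G hGs hG
      have hW : Expandable h s fun p c => h p * ∫ t in c..(1 : ℝ), G p t :=
        (hGs.integral_one hh hh1).mono hh hh1 (by omega)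
      have hWl : UniformO h (l + 1) fun p c => h p * ∫ t in c..(1 : ℝ), G p t :=
        (hG.integral (a := fun _ c => c) (b := fun _ _ => 1) (fun _ _ hc => hc)
          fun _ _ _ => ⟨zero_le_one, le_rfl⟩).step hh
      have h1 := hW.integral_mul_proj_sub hh hh1 (hg i)
      have h2 : UniformO h (2 * s) fun p _ => ∑ j, ∫ t in (0 : ℝ)..1,
          ((h p * ∫ x in t..(1 : ℝ), G p x) * A i j p t) * e j p t :=
        UniformO.sum _ fun j _ => ih (l + 1) (by omega) j _ (hW.mul hh hh1 (hA i j))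
          (by simpa using hWl.mul hh (hA0 i j))
      refine (h2.add h1).congr fun p c _ => ?_
      have hGc := hGs.continuous p
      have hWc := hW.continuous p
      have hψ : Continuous fun t => ∑ j, A i j p t * e j p t +
          (proj s (g i p) t - g i p t) := by fun_prop
      rw [intervalIntegral.integral_congr (g := fun t => h p * (G p t * ∫ x in (0 : ℝ)..t,
        (∑ j, A i j p x * e j p x + (proj s (g i p) x - g i p x))))
        fun t ht => by
          rw [uIcc_of_le zero_le_one] at ht
          simp only
          rw [eq i p t ht]
          ring,
        intervalIntegral.integral_const_mul, integral_tail_mul hGc hψ,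
        ← intervalIntegral.integral_const_mul,
        ← intervalIntegral.integral_finsetSum
          fun j _ => Continuous.intervalIntegrable (by fun_prop) _ _,
        ← intervalIntegral.integral_add
          (Continuous.intervalIntegrable (by fun_prop) _ _)
          (Continuous.intervalIntegrable (by fun_prop) _ _)]
      congr 1
      funext t
      rw [mul_add, Finset.mul_sum, mul_add, Finset.mul_sum, ← mul_assoc]
      congr 1
      exact Finset.sum_congr rfl fun j _ => by ring
  have h1 : UniformO h (2 * s) fun p _ => ∑ j, ∫ t in (0 : ℝ)..1, A i j p t * e j p t :=
    UniformO.sum _ fun j _ => key s 0 (zero_add s) j _ (hA i j) (hA0 i j)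
  refine (h1.step hh).congr fun p c _ => ?_
  rw [eq i p 1 ⟨zero_le_one, le_rfl⟩]
  have hgp := hgc i p
  rw [intervalIntegral.integral_add (Continuous.intervalIntegrable (by fun_prop) _ _)
    (Continuous.intervalIntegrable (by fun_prop) _ _),
    intervalIntegral.integral_finsetSum
      fun j _ => Continuous.intervalIntegrable (by fun_prop) _ _]
  -- The projection error has mean zero, as constants have degree below `s` once `s ≥ 1`; only `∫ A
  -- e` is left.
  have h3 := integral_eval_mul_proj_sub s 1
    (by rw [degree_one]; exact_mod_cast hs) hgp
  simp only [eval_one, one_mul] at h3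
  rw [h3, add_zero]

/-- The difference between the solutions of `u = y₀ + h ∫ Π F(u)` and `v = y₀ + h ∫ F(v)`. -/
theorem uniformO_projected_sub_exact [Fintype κ] (hh : ∀ p, 0 < h p) (hh1 : ∀ p, h p ≤ 1) {s : ℕ}
    (hs : 1 ≤ s) (F : κ → MvPolynomial κ ℝ) {u v : κ → P → ℝ → ℝ}
    (hu : ∀ i p, Continuous (u i p)) (hv : ∀ i p, Continuous (v i p))
    (hub : ∀ i, UniformO h 0 (u i)) (hvb : ∀ i, UniformO h 0 (v i))
    (h0 : ∀ i p, u i p 0 = v i p 0)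
    (hue : ∀ i p, ∀ c ∈ Icc (0 : ℝ) 1, u i p c = u i p 0 + h p * ∫ t in (0 : ℝ)..c,
      proj s (fun x => MvPolynomial.eval (fun k => u k p x) (F i)) t)
    (hve : ∀ i p, ∀ c ∈ Icc (0 : ℝ) 1, v i p c = v i p 0 + h p * ∫ t in (0 : ℝ)..c,
      MvPolynomial.eval (fun k => v k p t) (F i)) (i : κ) :
    UniformO h (2 * s + 1) fun p _ => u i p 1 - v i p 1 := by
  have hus : ∀ i, Expandable h s (u i) := Expandable.of_integral_eq hh hu hub
    (fun m hm hum i => (Expandable.eval_mvPolynomial hh hh1 hum (F i)).proj hh hh1 hm.le)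
    hue s le_rfl
  have hvs : ∀ i, Expandable h s (v i) := Expandable.of_integral_eq hh hv hvb
    (fun m hm hvm i => Expandable.eval_mvPolynomial hh hh1 hvm (F i)) hve s le_rfl
  have hFu := fun i => Expandable.eval_mvPolynomial hh hh1 hus (F i)
  choose A hA eA using fun i => Expandable.exists_sub_eq_sum hh hh1 hus hvs (F i)
  refine uniformO_endpoint hh hh1 (e := fun i p c => u i p c - v i p c)
    (fun i p => (hu i p).sub (hv i p)) (fun i => (hub i).sub (hvb i)) hA hFu
    (fun i p c hc => ?_) i hs
  rw [hue i p c hc, hve i p c hc, h0, add_sub_add_left_eq_sub, ← mul_sub,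
    ← intervalIntegral.integral_sub (Continuous.intervalIntegrable (by fun_prop) _ _)
      (((Expandable.eval_mvPolynomial hh hh1 hvs (F i)).continuous p).intervalIntegrable _ _)]
  congr 2
  funext t
  rw [← eA]
  ring

end

end HBVM

namespace HBVM

open Polynomial Set RungeKutta

/-! ### The polynomial path of HBVM(k,s) -/

theorem exists_antiderivative (q : ℝ[X]) :
    ∃ Q : ℝ[X], derivative Q = q ∧ Q.eval 0 = 0 ∧ Q.natDegree ≤ q.natDegree + 1 := by
  refine ⟨∑ j ∈ Finset.range (q.natDegree + 1), monomial (j + 1) (q.coeff j / (j + 1)), ?_, ?_, ?_⟩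
  · conv_rhs => rw [q.as_sum_range]
    rw [derivative_sum]
    refine Finset.sum_congr rfl fun j _ => ?_
    rw [derivative_monomial]
    have : (j : ℝ) + 1 ≠ 0 := by positivity
    push_cast
    rw [div_mul_cancel₀ _ this]
  · rw [eval_finsetSum]
    exact Finset.sum_eq_zero fun j _ => by simp [eval_monomial]
  · refine natDegree_sum_le_of_forall_le _ _ fun j hj => (natDegree_monomial_le _).trans ?_
    rw [Finset.mem_range] at hj
    omega

section

variable {E : Type*} [AddCommGroup E] [Module ℝ E] {k : ℕ}

/-- The Fourier–Legendre coefficient `∑ₗ b_l P_j(c_l) v_l` of the stage derivatives. -/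
noncomputable def stageCoeff (v : Fin k → E) (j : ℕ) : E :=
  ∑ l, (gaussWeight k l * (legendre j).eval (gaussNode k l)) • v l

/-- The path `σ(c) = y₀ + h ∑_{j<s} (∫₀^c P_j) γ_j`. -/
noncomputable def stagePath (s : ℕ) (h : ℝ) (y₀ : E) (v : Fin k → E) (c : ℝ) : E :=
  y₀ + h • ∑ j ∈ Finset.range s, (∫ x in (0 : ℝ)..c, (legendre j).eval x) • stageCoeff v j

theorem integral_legendre (j : ℕ) :
    ∫ x in (0 : ℝ)..1, (legendre j).eval x = if j = 0 then 1 else 0 := by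
  simpa [legendre_zero] using integral_legendre_mul_legendre j 0

theorem stagePath_zero (s : ℕ) (h : ℝ) (y₀ : E) (v : Fin k → E) : stagePath s h y₀ v 0 = y₀ := by
  simp [stagePath]

/-- Only `P_0` has nonzero mean, and `s ≥ 1` ensures that its term occurs in the sum. -/
theorem stagePath_one {s : ℕ} (hs : 1 ≤ s) (h : ℝ) (y₀ : E) (v : Fin k → E) :
    stagePath s h y₀ v 1 = y₀ + h • ∑ l, gaussWeight k l • v l := by
  simp only [stagePath, integral_legendre, ite_smul, one_smul, zero_smul, Finset.sum_ite_eq',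
    Finset.mem_range, if_pos (show 0 < s from hs)]
  simp [stageCoeff, legendre_zero]

theorem tableau_A_apply (k s : ℕ) (i l : Fin k) : (tableau k s).A i l =
    ∑ j ∈ Finset.range s, (∫ x in (0 : ℝ)..gaussNode k i, (legendre j).eval x) *
      (gaussWeight k l * (legendre j).eval (gaussNode k l)) := by
  change (matI k s * (matP k s).transpose * Matrix.diagonal (gaussWeight k)) i l = _
  rw [Matrix.mul_diagonal, Matrix.mul_apply, Finset.sum_mul, Finset.sum_range]
  refine Finset.sum_congr rfl fun j _ => ?_
  simp only [matI, matP, Matrix.of_apply, Matrix.transpose_apply]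
  ring

/-- This is what the coefficient matrix is designed for: the stages are the values of one polynomial
path at the nodes. -/
theorem stagePath_gaussNode (s : ℕ) (h : ℝ) (y₀ : E) (v : Fin k → E) (i : Fin k) :
    stagePath s h y₀ v (gaussNode k i) = y₀ + h • ∑ l, (tableau k s).A i l • v l := by
  simp only [stagePath, tableau_A_apply, stageCoeff, Finset.smul_sum, Finset.sum_smul, mul_smul]
  rw [Finset.sum_comm]

theorem exists_polynomial_stagePath (s : ℕ) (h : ℝ) (y₀ : E) (v : Fin k → E) (ℓ : E →ₗ[ℝ] ℝ) :
    ∃ S : ℝ[X], S.natDegree ≤ s ∧ (∀ c, S.eval c = ℓ (stagePath s h y₀ v c)) ∧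
      ∀ c, (derivative S).eval c =
        h * ∑ j ∈ Finset.range s, (legendre j).eval c * ℓ (stageCoeff v j) := by
  choose Q hQ hQ0 hQd using fun j => exists_antiderivative (legendre j)
  have hint : ∀ j c, ∫ x in (0 : ℝ)..c, (legendre j).eval x = (Q j).eval c := by
    intro j c
    rw [intervalIntegral.integral_eq_sub_of_hasDerivAt (f := fun x => (Q j).eval x)
      (fun x _ => by simpa [hQ] using (Q j).hasDerivAt x) (intervalIntegrable_eval _ _ _), hQ0,
      sub_zero]
  refine ⟨C (ℓ y₀) + C h * ∑ j ∈ Finset.range s, Q j * C (ℓ (stageCoeff v j)), ?_, fun c => ?_,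
    fun c => ?_⟩
  · refine natDegree_add_le_of_degree_le (by simp) ((natDegree_C_mul_le _ _).trans
      (natDegree_sum_le_of_forall_le _ _ fun j hj => (natDegree_mul_C_le _ _).trans
        ((hQd j).trans ?_)))
    rw [natDegree_legendre]
    exact Finset.mem_range.1 hj
  · simp [stagePath, hint, eval_finsetSum]
  · simp [derivative_mul, hQ, eval_finsetSum]

end

theorem eval_aeval {κ : Type*} (F : MvPolynomial κ ℝ) (S : κ → ℝ[X]) (c : ℝ) :
    (MvPolynomial.aeval S F).eval c = MvPolynomial.eval (fun i => (S i).eval c) F := by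
  induction F using MvPolynomial.induction_on with
  | C a => simp
  | add F G hF hG => simp [hF, hG]
  | mul_X F i hF => simp [hF]

/-! ### The order of HBVM(k,s) for polynomial vector fields -/

/-- For polynomial vector fields the path of HBVM(k,s) solves the projected integral equation. -/
theorem stagePath_integral_eq {E κ : Type*} [NormedAddCommGroup E] [NormedSpace ℝ E]
    (Φ : E ≃L[ℝ] (κ → ℝ)) {f : E → E} {F : κ → MvPolynomial κ ℝ}
    (hF : ∀ y i, Φ (f y) i = MvPolynomial.eval (Φ y) (F i)) {d k s : ℕ}
    (hd : ∀ i, (F i).totalDegree ≤ d) (hks : (d + 1) * s ≤ 2 * k) {h : ℝ} {y₀ : E}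
    {Y : Fin k → E} (hY : IsStages (tableau k s) f h y₀ Y) (i : κ) (c : ℝ) :
    Φ (stagePath s h y₀ (f ∘ Y) c) i = Φ y₀ i + h * ∫ t in (0 : ℝ)..c,
      proj s (fun x => MvPolynomial.eval (Φ (stagePath s h y₀ (f ∘ Y) x)) (F i)) t := by
  choose S hSd hS hS' using fun i => exists_polynomial_stagePath s h y₀ (f ∘ Y)
    ((LinearMap.proj i : (κ → ℝ) →ₗ[ℝ] ℝ) ∘ₗ (Φ.toLinearEquiv : E →ₗ[ℝ] (κ → ℝ)))
  have hS : ∀ i c, (S i).eval c = Φ (stagePath s h y₀ (f ∘ Y) c) i := hS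
  have hΦ : ∀ c, Φ (stagePath s h y₀ (f ∘ Y) c) = fun i => (S i).eval c := fun c =>
    funext fun i => (hS i c).symm
  have hcoeff : ∀ j < s, Φ (stageCoeff (f ∘ Y) j) i = ∫ t in (0 : ℝ)..1, (legendre j).eval t *
      MvPolynomial.eval (Φ (stagePath s h y₀ (f ∘ Y) t)) (F i) := by
    intro j hj
    -- The degree is at most `j + d s` with `j < s`, hence less than `(d + 1) s ≤ 2 k`.
    have hg := gauss_exact k (legendre j * MvPolynomial.aeval S (F i)) (by
      refine degree_le_natDegree.trans_lt ?_
      have h1 := MvPolynomial.aeval_natDegree_le (F i) (hd i) S hSd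
      have h2 : (legendre j * MvPolynomial.aeval S (F i)).natDegree ≤ j + d * s :=
        natDegree_mul_le.trans (add_le_add (natDegree_legendre j).le h1)
      have h3 : j + d * s < 2 * k := by linarith
      exact_mod_cast h2.trans_lt h3)
    simp only [eval_mul, eval_aeval] at hg
    simp only [hΦ]
    rw [hg]
    simp only [stageCoeff, map_sum, map_smul, Finset.sum_apply, Pi.smul_apply, smul_eq_mul,
      Function.comp_apply, hF]
    refine Finset.sum_congr rfl fun l _ => ?_
    rw [← hΦ, stagePath_gaussNode, mul_assoc]
    simp only [Function.comp_apply, ← hY l]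
  have h1 : ∀ t, (derivative (S i)).eval t = h * proj s (fun x =>
      MvPolynomial.eval (Φ (stagePath s h y₀ (f ∘ Y) x)) (F i)) t := by
    intro t
    rw [hS' i t, proj]
    congr 1
    refine Finset.sum_congr rfl fun j hj => ?_
    rw [← hcoeff j (Finset.mem_range.1 hj)]
    rfl
  have h2 := intervalIntegral.integral_eq_sub_of_hasDerivAt (a := 0) (b := c)
    (fun x _ => (S i).hasDerivAt x) (intervalIntegrable_eval _ _ _)
  simp_rw [h1] at h2
  rw [intervalIntegral.integral_const_mul, hS, hS, stagePath_zero] at h2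
  linarith

section

variable {E : Type*} [NormedAddCommGroup E] [NormedSpace ℝ E] {κ : Type*} [Fintype κ]

theorem contDiff_eval (F : MvPolynomial κ ℝ) :
    ContDiff ℝ 1 fun x : κ → ℝ => MvPolynomial.eval x F := by
  induction F using MvPolynomial.induction_on with
  | C a => simpa using contDiff_const
  | add F G hF hG => simpa using hF.add hG
  | mul_X F i hF => simpa using hF.mul (contDiff_apply ℝ ℝ i)

theorem exists_lipschitzOnWith_closedBall (Φ : E ≃L[ℝ] (κ → ℝ)) {f : E → E}
    {F : κ → MvPolynomial κ ℝ} (hF : ∀ y i, Φ (f y) i = MvPolynomial.eval (Φ y) (F i)) (r : ℝ) :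
    ∃ K : NNReal, LipschitzOnWith K f (Metric.closedBall 0 r) := by
  have : FiniteDimensional ℝ E := Φ.symm.toLinearEquiv.finiteDimensional
  have : ProperSpace E := FiniteDimensional.proper ℝ E
  have hf : f = fun y => Φ.symm fun i => MvPolynomial.eval (Φ y) (F i) := by
    funext y
    rw [ContinuousLinearEquiv.eq_symm_apply]
    exact funext fun i => hF y i
  have hc : ContDiff ℝ 1 f := by
    rw [hf]
    exact Φ.symm.contDiff.comp (contDiff_pi.2 fun i => (contDiff_eval (F i)).comp Φ.contDiff)
  exact hc.contDiffOn.exists_lipschitzOnWith one_ne_zero (convex_closedBall 0 r)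
    (isCompact_closedBall 0 r)

/-- While the solution stays in the ball its speed is at most `B`, so it cannot leave before time
`h`. The barrier has slope `B + 1` because the comparison principle needs a strict inequality where
the two curves touch. -/
theorem IsSolutionOn.norm_sub_le {f : E → E} {h R ρ B : ℝ} {y : ℝ → E} (hy : IsSolutionOn f h y)
    (hB0 : 0 ≤ B) (hB : ∀ x, ‖x‖ ≤ R + ρ → ‖f x‖ ≤ B) (hy0 : ‖y 0‖ ≤ R) (hs : h * (B + 1) ≤ ρ) :
    ∀ t ∈ Icc 0 h, ‖y t - y 0‖ ≤ ρ := by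
  intro t ht
  have hle : ∀ x ≤ h, (B + 1) * x ≤ ρ := fun x hx => by
    have : (B + 1) * x ≤ (B + 1) * h := by gcongr
    linarith
  refine (image_norm_le_of_norm_deriv_right_lt_deriv_boundary (f := fun t => y t - y 0)
    (f' := fun t => f (y t)) (B := fun t => (B + 1) * t) (B' := fun _ => B + 1)
    (hy.continuousOn.sub continuousOn_const) (fun x hx => ?_) (by simp) (fun x => ?_)
    (fun x hx hxe => ?_) ht).trans (hle t ht.2)
  · exact ((hy x ⟨hx.1, hx.2.le⟩).mono_of_mem_nhdsWithin
      (Filter.mem_of_superset (Icc_mem_nhdsGE hx.2) (Icc_subset_Icc_left hx.1))).sub_const _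
  · simpa using (hasDerivAt_id x).const_mul (B + 1)
  · have := norm_add_le (y 0) (y x - y 0)
    rw [add_sub_cancel] at this
    linarith [hB (y x) (by linarith [hle x hx.2.le])]

theorem IsSolutionOn.coord_eq {f : E → E} {h : ℝ} (hh : 0 < h) {y : ℝ → E}
    (hy : IsSolutionOn f h y) (ℓ : E →L[ℝ] ℝ) {w : ℝ → ℝ} (hw : Continuous w)
    (e : ∀ c ∈ Icc (0 : ℝ) 1, ℓ (f (y (h * c))) = w c) {c : ℝ} (hc : c ∈ Icc (0 : ℝ) 1) :
    ℓ (y (h * c)) = ℓ (y 0) + h * ∫ t in (0 : ℝ)..c, w t := by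
  have hmaps : MapsTo (fun t => h * t) (Icc 0 c) (Icc 0 h) := fun t ht =>
    ⟨mul_nonneg hh.le ht.1, mul_le_of_le_one_right hh.le (ht.2.trans hc.2)⟩
  have := intervalIntegral.integral_eq_sub_of_hasDerivAt_of_le hc.1
    (f := fun t => ℓ (y (h * t))) (f' := fun t => h * w t)
    (ℓ.continuous.comp_continuousOn (hy.continuousOn.comp (by fun_prop) hmaps)) (fun t ht => ?_)
    (Continuous.intervalIntegrable (by fun_prop) _ _)
  · rw [intervalIntegral.integral_const_mul, mul_zero] at this
    linarith
  · have ht1 : t < 1 := ht.2.trans_le hc.2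
    have h1 := (hy (h * t) (hmaps ⟨ht.1.le, ht.2.le⟩)).hasDerivAt
      (Icc_mem_nhds (mul_pos hh ht.1) (mul_lt_of_lt_one_right hh ht1))
    have h2 : HasDerivAt (fun t => h * t) h t := by simpa using (hasDerivAt_id t).const_mul h
    have h3 := ℓ.hasFDerivAt.comp_hasDerivAt t (h1.scomp t h2)
    rw [map_smul, e t ⟨ht.1.le, ht1.le⟩] at h3
    exact h3

theorem abs_apply_le (Φ : E ≃L[ℝ] (κ → ℝ)) (x : E) (i : κ) :
    |Φ x i| ≤ ‖(Φ : E →L[ℝ] (κ → ℝ))‖ * ‖x‖ :=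
  (norm_le_pi_norm (Φ x) i).trans ((Φ : E →L[ℝ] (κ → ℝ)).le_opNorm x)

/-- The parameters on which the constants in the local error estimate must not depend: stepsizes,
initial values, stages and exact solutions. -/
def LocalData (k s : ℕ) (f : E → E) (R ρ h₀ : ℝ) : Type _ :=
  {p : ℝ × (Fin k → E) × (ℝ → E) // p.1 ∈ Ioc 0 h₀ ∧ ‖p.2.2 0‖ ≤ R ∧
    IsStagesNear (tableau k s) f ρ p.1 (p.2.2 0) p.2.1 ∧ IsSolutionOn f p.1 p.2.2}

theorem uniformO_stagePath (Φ : E ≃L[ℝ] (κ → ℝ)) {f : E → E} {k s : ℕ} {R ρ h₀ B : ℝ}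
    (hR : 0 ≤ R) (hρ : 0 ≤ ρ) (hB : ∀ x, ‖x‖ ≤ R + ρ → ‖f x‖ ≤ B) (hh₀ : h₀ ≤ 1) (i : κ) :
    UniformO (fun p : LocalData k s f R ρ h₀ => p.1.1) 0
      fun p c => Φ (stagePath s p.1.1 (p.1.2.2 0) (f ∘ p.1.2.1) c) i := by
  have hB0 : 0 ≤ B := (norm_nonneg _).trans (hB 0 (by simpa using add_nonneg hR hρ))
  choose M hM0 hM using fun j => exists_bound_eval (legendre j)
  set Γ : ℕ → ℝ := fun j => ∑ l : Fin k, |gaussWeight k l * (legendre j).eval (gaussNode k l)| * B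
    with hΓ
  have hΓ0 : ∀ j, 0 ≤ Γ j := fun j =>
    Finset.sum_nonneg fun l _ => mul_nonneg (abs_nonneg _) hB0
  have hS0 : 0 ≤ ∑ j ∈ Finset.range s, M j * Γ j :=
    Finset.sum_nonneg fun j _ => mul_nonneg (hM0 j) (hΓ0 j)
  refine ⟨‖(Φ : E →L[ℝ] (κ → ℝ))‖ * (R + ∑ j ∈ Finset.range s, M j * Γ j), by positivity, ?_⟩
  rintro ⟨⟨h, Y, y⟩, hh, hy0, hY, hy⟩ c hc
  simp only at hh hy0 hY hy ⊢
  rw [pow_zero, mul_one]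
  refine (abs_apply_le Φ _ i).trans ?_
  gcongr
  refine (norm_add_le _ _).trans (add_le_add hy0 ?_)
  rw [norm_smul, Real.norm_of_nonneg hh.1.le]
  refine (mul_le_of_le_one_left (norm_nonneg _) (hh.2.trans hh₀)).trans ?_
  refine norm_sum_le_of_le _ fun j _ => ?_
  rw [norm_smul]
  refine mul_le_mul (abs_integral_le (hM j) ⟨le_rfl, zero_le_one⟩ hc) ?_ (norm_nonneg _) (hM0 j)
  refine norm_sum_le_of_le _ fun l _ => ?_
  rw [norm_smul, Real.norm_eq_abs]
  gcongr
  exact hB _ (hY.norm_le hy0 l)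

/-- Taking all admissible data as the parameter `p` in `UniformO` makes the constant independent of
the initial value, the stages and the exact solution. -/
theorem hasLocalOrder (Φ : E ≃L[ℝ] (κ → ℝ)) {f : E → E} {F : κ → MvPolynomial κ ℝ}
    (hF : ∀ y i, Φ (f y) i = MvPolynomial.eval (Φ y) (F i)) {d k s : ℕ} (hs : 1 ≤ s)
    (hd : ∀ i, (F i).totalDegree ≤ d) (hks : (d + 1) * s ≤ 2 * k) :
    HasLocalOrder (tableau k s) f (2 * s) := by
  have : FiniteDimensional ℝ E := Φ.symm.toLinearEquiv.finiteDimensional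
  have : CompleteSpace E := FiniteDimensional.complete ℝ E
  have hlip := exists_lipschitzOnWith_closedBall Φ hF
  intro R ρ hR hρ
  obtain ⟨h₁, h₁0, H₁⟩ := existsUnique_isStagesNear (tableau k s) hlip hR hρ
  obtain ⟨K, hK⟩ := hlip (R + ρ)
  set B := ‖f 0‖ + K * (R + ρ) with hBdef
  have hB : ∀ x, ‖x‖ ≤ R + ρ → ‖f x‖ ≤ B := fun x hx =>
    norm_le_of_lipschitzOnWith (by positivity) hK hx
  have hB0 : 0 ≤ B := by positivity
  obtain ⟨h₂, h₂0, H₂⟩ := exists_small (a := B + 1) (by positivity) hρ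
  set h₀ := min h₁ (min h₂ 1) with hh₀
  have hh₀1 : h₀ ≤ 1 := (min_le_right _ _).trans (min_le_right _ _)
  set P := LocalData k s f R ρ h₀
  have hpos : ∀ p : P, 0 < p.1.1 := fun p => p.2.1.1
  have hle1 : ∀ p : P, p.1.1 ≤ 1 := fun p => p.2.1.2.trans hh₀1
  have hynear : ∀ p : P, ∀ t ∈ Icc 0 p.1.1, ‖p.1.2.2 t‖ ≤ R + ρ := by
    rintro ⟨⟨h, Y, y⟩, hh, hy0, hY, hy⟩ t ht
    have h1 := IsSolutionOn.norm_sub_le hy hB0 hB hy0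
      (H₂ h hh.1 (hh.2.trans ((min_le_right _ _).trans (min_le_left _ _)))) t ht
    have h2 := norm_add_le (y 0) (y t - y 0)
    rw [add_sub_cancel] at h2
    simp only at h1 hy0 ⊢
    linarith
  -- The exact solution is controlled only on `[0, h]`, while expandable families are continuous on
  -- all of `ℝ`; clamping `c` to `[0, 1]` extends it continuously.
  have hclamp : ∀ c : ℝ, max 0 (min c 1) ∈ Icc (0 : ℝ) 1 := fun c =>
    ⟨le_max_left _ _, max_le zero_le_one (min_le_right _ _)⟩
  have hclamp_eq : ∀ c ∈ Icc (0 : ℝ) 1, max 0 (min c 1) = c := fun c hc => by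
    rw [min_eq_left hc.2, max_eq_right hc.1]
  have hmem : ∀ p : P, ∀ c ∈ Icc (0 : ℝ) 1, p.1.1 * c ∈ Icc 0 p.1.1 := fun p c hc =>
    ⟨mul_nonneg (hpos p).le hc.1, mul_le_of_le_one_right (hpos p).le hc.2⟩
  set u : κ → P → ℝ → ℝ := fun i p c => Φ (stagePath s p.1.1 (p.1.2.2 0) (f ∘ p.1.2.1) c) i
    with hu
  set v : κ → P → ℝ → ℝ := fun i p c => Φ (p.1.2.2 (p.1.1 * max 0 (min c 1))) i with hv
  have hvc : ∀ i p, Continuous (v i p) := by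
    intro i p
    have h1 : Continuous fun c : ℝ => p.1.2.2 (p.1.1 * max 0 (min c 1)) :=
      p.2.2.2.2.continuousOn.comp_continuous (by fun_prop) fun c => hmem p _ (hclamp c)
    exact (continuous_apply i).comp (Φ.continuous.comp h1)
  have main : ∀ i, UniformO (fun p : P => p.1.1) (2 * s + 1) fun p _ => u i p 1 - v i p 1 := by
    refine uniformO_projected_sub_exact hpos hle1 hs F (fun i p => ?_) hvc
      (uniformO_stagePath Φ hR.le hρ.le hB hh₀1) (fun i => ?_) (fun i p => ?_)
      (fun i p c hc => ?_) (fun i p c hc => ?_)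
    · obtain ⟨S, -, hS, -⟩ := exists_polynomial_stagePath s p.1.1 (p.1.2.2 0) (f ∘ p.1.2.1)
        ((LinearMap.proj i : (κ → ℝ) →ₗ[ℝ] ℝ) ∘ₗ (Φ.toLinearEquiv : E →ₗ[ℝ] (κ → ℝ)))
      exact S.continuous.congr hS
    · refine ⟨‖(Φ : E →L[ℝ] (κ → ℝ))‖ * (R + ρ), by positivity, fun p c hc => ?_⟩
      rw [pow_zero, mul_one]
      refine (abs_apply_le Φ _ i).trans ?_
      gcongr
      exact hynear p _ (hmem p _ (hclamp c))
    · simp [hu, hv, stagePath_zero]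
    · simp only [hu]
      rw [stagePath_integral_eq Φ hF hd hks p.2.2.2.1.1 i c, stagePath_zero]
    · have h1 := IsSolutionOn.coord_eq (hpos p) p.2.2.2.2
        ((ContinuousLinearMap.proj i : (κ → ℝ) →L[ℝ] ℝ).comp (Φ : E →L[ℝ] (κ → ℝ)))
        (w := fun t => MvPolynomial.eval (fun k => v k p t) (F i))
        ((MvPolynomial.continuous_eval (F i)).comp (continuous_pi fun k => hvc k p))
        (fun c hc => by
          simp only [hv, hclamp_eq c hc]
          exact hF _ i) hc
      simp only [hv, hclamp_eq c hc, hclamp_eq 0 ⟨le_rfl, zero_le_one⟩, mul_zero]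
      exact h1
  choose C hC0 hC using main
  refine ⟨h₀, by positivity, ‖(Φ.symm : (κ → ℝ) →L[ℝ] E)‖ * ∑ i, C i, fun y₀ hy₀ h hh =>
    ⟨H₁ y₀ hy₀ h ⟨hh.1, hh.2.trans (min_le_left _ _)⟩, ?_⟩⟩
  rintro Y hY y hy rfl
  set p : P := ⟨(h, Y, y), hh, hy₀, hY, hy⟩ with hp
  have hΦ : ‖Φ (update (tableau k s) f h (y 0) Y - y h)‖ ≤ (∑ i, C i) * h ^ (2 * s + 1) := by
    have hhp : 0 ≤ h ^ (2 * s + 1) := pow_nonneg hh.1.le _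
    refine (pi_norm_le_iff_of_nonneg
      (mul_nonneg (Finset.sum_nonneg fun i _ => hC0 i) hhp)).2 fun i => ?_
    have h1 := hC i p 1 ⟨zero_le_one, le_rfl⟩
    simp only [hu, hv, hclamp_eq 1 ⟨zero_le_one, le_rfl⟩, mul_one, hp, stagePath_one hs] at h1
    rw [map_sub]
    refine h1.trans ?_
    gcongr
    exact Finset.single_le_sum (fun i _ => hC0 i) (Finset.mem_univ i)
  have h2 := (Φ.symm : (κ → ℝ) →L[ℝ] E).le_opNorm
    (Φ (update (tableau k s) f h (y 0) Y - y h))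
  simp only [ContinuousLinearEquiv.coe_coe, ContinuousLinearEquiv.symm_apply_apply] at h2
  rw [mul_assoc]
  exact h2.trans (by gcongr)

end

end HBVM

/-! ### The Manakov field and Hamiltonian in coordinates. -/

namespace Manakov

open scoped Matrix Kronecker

@[fun_prop]
theorem continuous_basisFun (a b : ℝ) (j : ℕ) : Continuous (basisFun a b j) := by
  unfold basisFun
  split_ifs <;> fun_prop

@[fun_prop]
theorem continuous_basisVec (a b : ℝ) (N : ℕ) (j : Fin (2 * N + 1)) :
    Continuous fun x => basisVec a b N x j :=
  continuous_basisFun a b j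

theorem matQ_mulVec {n : ℕ} (u : Fin n × Fin 2 → ℝ) (i : Fin n × Fin 2) :
    (matQ n *ᵥ u) i = u (i.1, 0) + u (i.1, 1) := by
  obtain ⟨i, e⟩ := i
  fin_cases e <;>
  simp [matQ, Matrix.mulVec, dotProduct, Fintype.sum_prod_type, Matrix.one_apply]

theorem gamma2_mulVec {n : ℕ} (γ : Matrix (Fin n) (Fin n) ℝ) (u : Fin n × Fin 2 → ℝ)
    (i : Fin n × Fin 2) : (gamma2 γ *ᵥ u) i = ∑ k, γ i.1 k * u (k, i.2) := by
  obtain ⟨i, e⟩ := i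
  fin_cases e <;>
  simp [gamma2, Matrix.mulVec, dotProduct, Fintype.sum_prod_type]

theorem beta2_eq_diagonal {n : ℕ} (β : Fin n → ℝ) :
    beta2 β = Matrix.diagonal fun i : Fin n × Fin 2 => β i.1 := by
  rw [beta2, ← Matrix.diagonal_one, Matrix.diagonal_kronecker_diagonal]
  simp

theorem matJ_mul_zero {n : ℕ} {ι : Type*} (A : Matrix (Fin n × Fin 2) ι ℝ) (i : Fin n) (j : ι) :
    (matJ n * A) (i, 0) j = A (i, 1) j := by
  simp [matJ, Matrix.mul_apply, Fintype.sum_prod_type, Matrix.one_apply]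

theorem matJ_mul_one {n : ℕ} {ι : Type*} (A : Matrix (Fin n × Fin 2) ι ℝ) (i : Fin n) (j : ι) :
    (matJ n * A) (i, 1) j = -A (i, 0) j := by
  simp [matJ, Matrix.mul_apply, Fintype.sum_prod_type, Matrix.one_apply]

/-- The value `∑ₐ y_{ka} w_a(x)` of the `k`-th component. -/
noncomputable def component {n : ℕ} (a b : ℝ) (N : ℕ) (y : State n N) (x : ℝ)
    (k : Fin n × Fin 2) : ℝ :=
  ∑ j, y k j * basisVec a b N x j

/-- The density `|ψ_i|² = q_i² + p_i²` of the `i`-th field. -/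
noncomputable def density {n : ℕ} (a b : ℝ) (N : ℕ) (y : State n N) (x : ℝ) (i : Fin n) : ℝ :=
  component a b N y x (i, 0) ^ 2 + component a b N y x (i, 1) ^ 2

variable {n : ℕ} (a b : ℝ) (N : ℕ) (β : Fin n → ℝ) (γ : Matrix (Fin n) (Fin n) ℝ)

@[fun_prop]
theorem continuous_component (y : State n N) (k : Fin n × Fin 2) :
    Continuous fun x => component a b N y x k := by
  unfold component
  fun_prop

@[fun_prop]
theorem continuous_density (y : State n N) (i : Fin n) :
    Continuous fun x => density a b N y x i := by
  unfold density
  fun_prop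

/-- The gradient of the Hamiltonian. -/
noncomputable def gradient (y : State n N) : State n N :=
  Matrix.of fun i j => β i.1 * freq a b j ^ 2 * y i j -
    ∫ x in a..b, (∑ k, γ i.1 k * density a b N y x k) * component a b N y x i *
      basisVec a b N x j

theorem field_eq (y : State n N) : field a b N β γ y = matJ n * gradient a b N β γ y := by
  rw [field]
  congr 1
  ext i j
  rw [Matrix.sub_apply, gradient, Matrix.of_apply, Matrix.of_apply, beta2_eq_diagonal, matD,
    Matrix.diagonal_pow, Matrix.mul_diagonal, Matrix.diagonal_mul]
  congr 1
  · simp only [Pi.pow_apply]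
    ring
  · congr 1
    funext x
    rw [Matrix.vecMulVec_apply, Pi.mul_apply, ← Matrix.mulVec_mulVec, gamma2_mulVec]
    simp only [matQ_mulVec, Pi.pow_apply]
    rfl

theorem hamiltonian_eq (y : State n N) : hamiltonian a b N β γ y =
    1 / 2 * (∑ i, ∑ j : Fin (2 * N + 1), β i.1 * freq a b j ^ 2 * y i j ^ 2) -
      1 / 4 * ∫ x in a..b, ∑ i, ∑ k, γ i k * density a b N y x i * density a b N y x k := by
  have h1 : ∀ j : Fin (2 * N + 1), y.col j ⬝ᵥ beta2 β *ᵥ y.col j = ∑ i, β i.1 * y i j ^ 2 := by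
    intro j
    rw [beta2_eq_diagonal, dotProduct]
    refine Finset.sum_congr rfl fun i _ => ?_
    rw [Matrix.mulVec_diagonal, Matrix.col_apply]
    ring
  -- `Q` puts the density of each field into both components of its block, whence the factor `2`
  -- that turns `1/8` into `1/4`.
  have h2 : ∀ x, (matQ n *ᵥ (y *ᵥ basisVec a b N x) ^ 2) ⬝ᵥ
        (gamma2 γ *ᵥ (matQ n *ᵥ (y *ᵥ basisVec a b N x) ^ 2)) =
      2 * ∑ i, ∑ k, γ i k * density a b N y x i * density a b N y x k := by
    intro x
    have e : ∀ i, (matQ n *ᵥ (y *ᵥ basisVec a b N x) ^ 2) i = density a b N y x i.1 := fun i => by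
      rw [matQ_mulVec]
      rfl
    simp only [dotProduct, gamma2_mulVec, e, Fintype.sum_prod_type, Fin.sum_univ_two]
    rw [Finset.mul_sum]
    refine Finset.sum_congr rfl fun i _ => ?_
    rw [← two_mul, Finset.mul_sum]
    congr 1
    exact Finset.sum_congr rfl fun k _ => by ring
  rw [hamiltonian]
  simp only [h1, h2]
  rw [intervalIntegral.integral_const_mul, Finset.sum_comm]
  simp only [Finset.mul_sum]
  congr 1
  · refine Finset.sum_congr rfl fun i _ => Finset.sum_congr rfl fun j _ => by ring
  · ring

/-! ### The field is a cubic polynomial map -/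

/-- The coordinates of a state. -/
noncomputable def coords (n N : ℕ) :
    State n N ≃L[ℝ] ((Fin n × Fin 2) × Fin (2 * N + 1) → ℝ) :=
  LinearEquiv.toContinuousLinearEquiv
    { toFun := fun y p => y p.1 p.2
      invFun := fun v => Matrix.of fun i j => v (i, j)
      left_inv := fun _ => rfl
      right_inv := fun _ => rfl
      map_add' := fun _ _ => rfl
      map_smul' := fun _ _ => rfl }

theorem coords_apply (y : State n N) (p : (Fin n × Fin 2) × Fin (2 * N + 1)) :
    coords n N y p = y p.1 p.2 := rfl

open MvPolynomial in
/-- The polynomial map representing the gradient. -/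
noncomputable def gradientPoly (i : Fin n × Fin 2) (j : Fin (2 * N + 1)) :
    MvPolynomial ((Fin n × Fin 2) × Fin (2 * N + 1)) ℝ :=
  C (β i.1 * freq a b j ^ 2) * X (i, j) -
    ∑ k, ∑ e : Fin 2, ∑ p, ∑ q, ∑ r,
      C (γ i.1 k * ∫ x in a..b, basisVec a b N x p * basisVec a b N x q * basisVec a b N x r *
        basisVec a b N x j) * (X ((k, e), p) * X ((k, e), q) * X (i, r))

theorem sum_mul_sum_mul_sum {ι : Type*} [Fintype ι] (f g h : ι → ℝ) :
    (∑ p, f p) * (∑ q, g q) * ∑ r, h r = ∑ p, ∑ q, ∑ r, f p * g q * h r := by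
  rw [Finset.sum_mul_sum, Finset.sum_mul]
  exact Finset.sum_congr rfl fun p _ => Finset.sum_mul_sum _ _ _ _

/-- The cubic integrand is expanded in the entries of `y`; only products of four basis functions
depend on `x`, and their integrals become the coefficients. -/
theorem eval_gradientPoly (y : State n N) (i : Fin n × Fin 2) (j : Fin (2 * N + 1)) :
    MvPolynomial.eval (coords n N y) (gradientPoly a b N β γ i j) =
      gradient a b N β γ y i j := by
  have h : ∀ x, (∑ k, γ i.1 k * density a b N y x k) * component a b N y x i *
      basisVec a b N x j = ∑ k, ∑ e : Fin 2, ∑ p, ∑ q, ∑ r,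
        γ i.1 k * (basisVec a b N x p * basisVec a b N x q * basisVec a b N x r *
          basisVec a b N x j) * (y (k, e) p * y (k, e) q * y i r) := by
    intro x
    rw [Finset.sum_mul, Finset.sum_mul]
    refine Finset.sum_congr rfl fun k _ => ?_
    have hd : density a b N y x k = ∑ e : Fin 2, component a b N y x (k, e) ^ 2 := by
      rw [Fin.sum_univ_two, density]
    rw [hd, Finset.mul_sum, Finset.sum_mul, Finset.sum_mul]
    refine Finset.sum_congr rfl fun e _ => ?_
    have h3 := sum_mul_sum_mul_sum (fun p => y (k, e) p * basisVec a b N x p)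
      (fun p => y (k, e) p * basisVec a b N x p) (fun p => y i p * basisVec a b N x p)
    calc _ = (component a b N y x (k, e) * component a b N y x (k, e) * component a b N y x i) *
          (γ i.1 k * basisVec a b N x j) := by ring
      _ = _ := by
        simp only [component]
        rw [h3]
        simp only [Finset.sum_mul]
        refine Finset.sum_congr rfl fun p _ => Finset.sum_congr rfl fun q _ =>
          Finset.sum_congr rfl fun r _ => by ring
  rw [gradientPoly, gradient, Matrix.of_apply]
  simp only [h]
  simp only [map_sub, map_mul, map_sum, MvPolynomial.eval_C, MvPolynomial.eval_X, coords_apply]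
  congr 1
  rw [intervalIntegral.integral_finsetSum
    fun _ _ => Continuous.intervalIntegrable (by fun_prop) _ _]
  refine Finset.sum_congr rfl fun k _ => ?_
  rw [intervalIntegral.integral_finsetSum
    fun _ _ => Continuous.intervalIntegrable (by fun_prop) _ _]
  refine Finset.sum_congr rfl fun e _ => ?_
  rw [intervalIntegral.integral_finsetSum
    fun _ _ => Continuous.intervalIntegrable (by fun_prop) _ _]
  refine Finset.sum_congr rfl fun p _ => ?_
  rw [intervalIntegral.integral_finsetSum
    fun _ _ => Continuous.intervalIntegrable (by fun_prop) _ _]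
  refine Finset.sum_congr rfl fun q _ => ?_
  rw [intervalIntegral.integral_finsetSum
    fun _ _ => Continuous.intervalIntegrable (by fun_prop) _ _]
  refine Finset.sum_congr rfl fun r _ => ?_
  rw [intervalIntegral.integral_mul_const, intervalIntegral.integral_const_mul]

theorem totalDegree_gradientPoly_le (i : Fin n × Fin 2) (j : Fin (2 * N + 1)) :
    (gradientPoly a b N β γ i j).totalDegree ≤ 3 := by
  have hX : ∀ p : (Fin n × Fin 2) × Fin (2 * N + 1),
      (MvPolynomial.X p : MvPolynomial _ ℝ).totalDegree ≤ 1 := fun p =>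
    (MvPolynomial.totalDegree_X p).le
  have hC : ∀ (c : ℝ) {m : ℕ} {p : MvPolynomial ((Fin n × Fin 2) × Fin (2 * N + 1)) ℝ},
      p.totalDegree ≤ m → (MvPolynomial.C c * p).totalDegree ≤ m := fun c m p hp => by
    refine (MvPolynomial.totalDegree_mul _ _).trans ?_
    rwa [MvPolynomial.totalDegree_C, zero_add]
  rw [gradientPoly]
  refine (MvPolynomial.totalDegree_sub _ _).trans (max_le (hC _ ((hX _).trans (by norm_num))) ?_)
  refine MvPolynomial.totalDegree_finsetSum_le fun k _ =>
    MvPolynomial.totalDegree_finsetSum_le fun e _ =>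
    MvPolynomial.totalDegree_finsetSum_le fun p _ =>
    MvPolynomial.totalDegree_finsetSum_le fun q _ =>
    MvPolynomial.totalDegree_finsetSum_le fun r _ => hC _ ?_
  exact (MvPolynomial.totalDegree_mul _ _).trans
    (add_le_add ((MvPolynomial.totalDegree_mul _ _).trans (add_le_add (hX _) (hX _))) (hX _))

/-- The polynomial map representing the field. -/
noncomputable def fieldPoly (p : (Fin n × Fin 2) × Fin (2 * N + 1)) :
    MvPolynomial ((Fin n × Fin 2) × Fin (2 * N + 1)) ℝ :=
  if p.1.2 = 0 then gradientPoly a b N β γ (p.1.1, 1) p.2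
  else -gradientPoly a b N β γ (p.1.1, 0) p.2

theorem eval_fieldPoly (y : State n N) (p : (Fin n × Fin 2) × Fin (2 * N + 1)) :
    coords n N (field a b N β γ y) p =
      MvPolynomial.eval (coords n N y) (fieldPoly a b N β γ p) := by
  obtain ⟨⟨i, e⟩, j⟩ := p
  rw [coords_apply, field_eq]
  fin_cases e
  · simpa [fieldPoly, eval_gradientPoly] using matJ_mul_zero _ i j
  · simpa [fieldPoly, eval_gradientPoly] using matJ_mul_one _ i j

theorem totalDegree_fieldPoly_le (p : (Fin n × Fin 2) × Fin (2 * N + 1)) :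
    (fieldPoly a b N β γ p).totalDegree ≤ 3 := by
  rw [fieldPoly]
  split_ifs
  · exact totalDegree_gradientPoly_le a b N β γ _ _
  · rw [MvPolynomial.totalDegree_neg]
    exact totalDegree_gradientPoly_le a b N β γ _ _

/-- For degree `d = 3` and `k = 2 s` nodes the condition `(d + 1) s ≤ 2 k` holds with equality. -/
theorem hasLocalOrder_field {s : ℕ} (hs : 1 ≤ s) :
    RungeKutta.HasLocalOrder (HBVM.tableau (2 * s) s) (field a b N β γ) (2 * s) :=
  HBVM.hasLocalOrder (coords n N) (eval_fieldPoly a b N β γ) hs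
    (totalDegree_fieldPoly_le a b N β γ) (by omega)

theorem hasGlobalOrder_field {s : ℕ} (hs : 1 ≤ s) :
    RungeKutta.HasGlobalOrder (HBVM.tableau (2 * s) s) (field a b N β γ) (2 * s) :=
  (hasLocalOrder_field a b N β γ hs).hasGlobalOrder (by omega)
    (HBVM.exists_lipschitzOnWith_closedBall (coords n N) (eval_fieldPoly a b N β γ))

/-! ### Energy conservation -/

open Polynomial in
theorem eval_one_sub_eval_zero {k : ℕ} (hk : 1 ≤ k) (p : ℝ[X]) (hp : p.natDegree ≤ 2 * k) :
    p.eval 1 - p.eval 0 =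
      ∑ l, HBVM.gaussWeight k l * (derivative p).eval (HBVM.gaussNode k l) := by
  rw [← HBVM.integral_derivative_eval, HBVM.gauss_exact]
  refine degree_le_natDegree.trans_lt ?_
  have := natDegree_derivative_le p
  exact_mod_cast (by omega : (derivative p).natDegree < 2 * k)

open Polynomial in
/-- The discrete line integral: along polynomial paths of degree at most `s` the increment of the
Hamiltonian is computed exactly by the Gauss formula with `2 s` nodes. -/
theorem hamiltonian_sub_eq (hγ : γ.IsSymm) {s : ℕ} (hs : 1 ≤ s) (σ : ℝ → State n N)
    (S : Fin n × Fin 2 → Fin (2 * N + 1) → ℝ[X]) (hSd : ∀ i j, (S i j).natDegree ≤ s)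
    (hS : ∀ i j c, (S i j).eval c = σ c i j) :
    hamiltonian a b N β γ (σ 1) - hamiltonian a b N β γ (σ 0) =
      ∑ l, HBVM.gaussWeight (2 * s) l * ∑ i, ∑ j,
        gradient a b N β γ (σ (HBVM.gaussNode (2 * s) l)) i j *
          (derivative (S i j)).eval (HBVM.gaussNode (2 * s) l) := by
  set c := HBVM.gaussNode (2 * s) with hc
  set w := HBVM.gaussWeight (2 * s) with hw
  have hquad : ∀ i j, σ 1 i j ^ 2 - σ 0 i j ^ 2 =
      ∑ l, w l * (2 * σ (c l) i j * (derivative (S i j)).eval (c l)) := by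
    intro i j
    have := eval_one_sub_eval_zero (k := 2 * s) (by omega) (S i j ^ 2)
      (natDegree_pow_le.trans (by nlinarith [hSd i j]))
    simpa [derivative_pow, hS, mul_assoc] using this
  -- At a fixed `x` the quartic density is a polynomial in `c` of degree at most `4 s`; the space
  -- integral is applied only afterwards.
  have hquart : ∀ x, (∑ i, ∑ k, γ i k * density a b N (σ 1) x i * density a b N (σ 1) x k) -
      (∑ i, ∑ k, γ i k * density a b N (σ 0) x i * density a b N (σ 0) x k) =
      ∑ l, w l * ∑ i, ∑ j, 4 * (((∑ k, γ i.1 k * density a b N (σ (c l)) x k) *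
        component a b N (σ (c l)) x i * basisVec a b N x j) *
          (derivative (S i j)).eval (c l)) := by
    intro x
    set V : Fin n × Fin 2 → ℝ[X] := fun i => ∑ j, S i j * C (basisVec a b N x j) with hV
    have hVd : ∀ i, (V i).natDegree ≤ s := fun i =>
      natDegree_sum_le_of_forall_le _ _ fun j _ => (natDegree_mul_C_le _ _).trans (hSd i j)
    have hVe : ∀ i t, (V i).eval t = component a b N (σ t) x i := fun i t => by
      simp [hV, eval_finsetSum, hS, component]
    have hV' : ∀ i t, (derivative (V i)).eval t =
        ∑ j, basisVec a b N x j * (derivative (S i j)).eval t := fun i t => by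
      simp [hV, eval_finsetSum, derivative_mul, mul_comm]
    set ρ : Fin n → ℝ[X] := fun i => V (i, 0) ^ 2 + V (i, 1) ^ 2 with hρ
    have hρd : ∀ i, (ρ i).natDegree ≤ 2 * s := fun i =>
      natDegree_add_le_of_degree_le
        (natDegree_pow_le.trans (by nlinarith [hVd (i, 0)]))
        (natDegree_pow_le.trans (by nlinarith [hVd (i, 1)]))
    have hρe : ∀ i t, (ρ i).eval t = density a b N (σ t) x i := fun i t => by
      simp [hρ, hVe, density]
    have hρ' : ∀ i t, (derivative (ρ i)).eval t =
        ∑ e : Fin 2, 2 * component a b N (σ t) x (i, e) * (derivative (V (i, e))).eval t := by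
      intro i t
      simp [hρ, hVe, derivative_pow, Fin.sum_univ_two]
    have := eval_one_sub_eval_zero (k := 2 * s) (by omega) (∑ i, ∑ k, C (γ i k) * ρ i * ρ k)
      (natDegree_sum_le_of_forall_le _ _ fun i _ => natDegree_sum_le_of_forall_le _ _ fun k _ =>
        natDegree_mul_le.trans (by
          have := (natDegree_C_mul_le (γ i k) (ρ i)).trans (hρd i)
          have := hρd k
          omega))
    simp only [eval_finsetSum, eval_mul, eval_C, hρe] at this
    rw [this]
    refine Finset.sum_congr rfl fun l _ => ?_
    congr 1
    -- Symmetry of `γ` makes the two terms of the product rule equal.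
    have hsymm : ∑ i, ∑ k, γ i k * density a b N (σ (c l)) x i * (derivative (ρ k)).eval (c l) =
        ∑ i, ∑ k, γ i k * density a b N (σ (c l)) x k * (derivative (ρ i)).eval (c l) := by
      rw [Finset.sum_comm]
      refine Finset.sum_congr rfl fun i _ => Finset.sum_congr rfl fun k _ => ?_
      rw [hγ.apply]
    calc _ = ∑ i, ∑ k, (γ i k * density a b N (σ (c l)) x k * (derivative (ρ i)).eval (c l) +
          γ i k * density a b N (σ (c l)) x i * (derivative (ρ k)).eval (c l)) := by
          simp only [derivative_sum, eval_finsetSum]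
          refine Finset.sum_congr rfl fun i _ => Finset.sum_congr rfl fun k _ => ?_
          simp only [derivative_mul, derivative_C, zero_mul, zero_add, eval_add, eval_mul, eval_C,
            hρe]
          ring
      _ = 2 * ∑ i, ∑ k, γ i k * density a b N (σ (c l)) x k *
          (derivative (ρ i)).eval (c l) := by
          simp only [Finset.sum_add_distrib]
          rw [hsymm]
          ring
      _ = _ := by
          rw [Fintype.sum_prod_type, Finset.mul_sum]
          refine Finset.sum_congr rfl fun i _ => ?_
          rw [← Finset.sum_mul, hρ', Finset.mul_sum, Finset.mul_sum]
          refine Finset.sum_congr rfl fun e _ => ?_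
          rw [hV', Finset.mul_sum, Finset.mul_sum, Finset.mul_sum]
          exact Finset.sum_congr rfl fun j _ => by ring
  have hint : ∀ y : State n N, IntervalIntegrable
      (fun x => ∑ i, ∑ k, γ i k * density a b N y x i * density a b N y x k)
      MeasureTheory.volume a b := fun y => Continuous.intervalIntegrable (by fun_prop) _ _
  have hquart2 : (∫ x in a..b, ∑ i, ∑ k, γ i k * density a b N (σ 1) x i *
      density a b N (σ 1) x k) - (∫ x in a..b, ∑ i, ∑ k, γ i k * density a b N (σ 0) x i *
      density a b N (σ 0) x k) = ∑ l, w l * ∑ i, ∑ j,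
        4 * ((∫ x in a..b, (∑ k, γ i.1 k * density a b N (σ (c l)) x k) *
          component a b N (σ (c l)) x i * basisVec a b N x j) *
          (derivative (S i j)).eval (c l)) := by
    rw [← intervalIntegral.integral_sub (hint _) (hint _)]
    simp only [hquart]
    rw [intervalIntegral.integral_finsetSum
      fun _ _ => Continuous.intervalIntegrable (by fun_prop) _ _]
    refine Finset.sum_congr rfl fun l _ => ?_
    rw [intervalIntegral.integral_const_mul, intervalIntegral.integral_finsetSum
      fun _ _ => Continuous.intervalIntegrable (by fun_prop) _ _]
    congr 1
    refine Finset.sum_congr rfl fun i _ => ?_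
    rw [intervalIntegral.integral_finsetSum
      fun _ _ => Continuous.intervalIntegrable (by fun_prop) _ _]
    refine Finset.sum_congr rfl fun j _ => ?_
    rw [intervalIntegral.integral_const_mul, intervalIntegral.integral_mul_const]
  have hquad2 : (∑ i, ∑ j : Fin (2 * N + 1), β i.1 * freq a b j ^ 2 * σ 1 i j ^ 2) -
      (∑ i, ∑ j : Fin (2 * N + 1), β i.1 * freq a b j ^ 2 * σ 0 i j ^ 2) =
      ∑ l, w l * ∑ i, ∑ j : Fin (2 * N + 1),
        2 * (β i.1 * freq a b j ^ 2 * σ (c l) i j * (derivative (S i j)).eval (c l)) := by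
    simp only [← Finset.sum_sub_distrib, ← mul_sub, hquad, Finset.mul_sum]
    conv_rhs => rw [Finset.sum_comm]
    refine Finset.sum_congr rfl fun i _ => ?_
    conv_rhs => rw [Finset.sum_comm]
    refine Finset.sum_congr rfl fun j _ => Finset.sum_congr rfl fun l _ => by ring
  rw [hamiltonian_eq, hamiltonian_eq, sub_sub_sub_comm, ← mul_sub, ← mul_sub, hquad2, hquart2,
    Finset.mul_sum, Finset.mul_sum, ← Finset.sum_sub_distrib]
  refine Finset.sum_congr rfl fun l _ => ?_
  rw [mul_left_comm, mul_left_comm (1 / 4), ← mul_sub, Finset.mul_sum, Finset.mul_sum,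
    ← Finset.sum_sub_distrib]
  congr 1
  refine Finset.sum_congr rfl fun i _ => ?_
  rw [Finset.mul_sum, Finset.mul_sum, ← Finset.sum_sub_distrib]
  refine Finset.sum_congr rfl fun j _ => ?_
  rw [gradient, Matrix.of_apply]
  ring

theorem sum_mul_matJ_mul (A : State n N) : ∑ i, ∑ j, A i j * (matJ n * A) i j = 0 := by
  rw [Fintype.sum_prod_type]
  refine Finset.sum_eq_zero fun i _ => ?_
  rw [Fin.sum_univ_two, ← Finset.sum_add_distrib]
  refine Finset.sum_eq_zero fun j _ => ?_
  rw [matJ_mul_zero, matJ_mul_one]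
  ring

/-- The quadrature sum for the energy increment regroups, one Legendre index at a time, into `h ∑_m
⟨g m, J g m⟩`. This is an algebraic identity, so neither the size of `h` nor the choice of stage
solution matters. -/
theorem conserves_field (hγ : γ.IsSymm) {s : ℕ} (hs : 1 ≤ s) :
    RungeKutta.Conserves (HBVM.tableau (2 * s) s) (field a b N β γ)
      (hamiltonian a b N β γ) := by
  intro h y₀ Y hY
  set σ := HBVM.stagePath s h y₀ (field a b N β γ ∘ Y) with hσ
  have h1 : RungeKutta.update (HBVM.tableau (2 * s) s) (field a b N β γ) h y₀ Y = σ 1 :=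
    (HBVM.stagePath_one hs h y₀ (field a b N β γ ∘ Y)).symm
  have h0 : σ 0 = y₀ := HBVM.stagePath_zero s h y₀ _
  have hnode : ∀ l, σ (HBVM.gaussNode (2 * s) l) = Y l := fun l => by
    rw [hσ, HBVM.stagePath_gaussNode]
    exact (hY l).symm
  choose S hSd hS hS' using fun i j => HBVM.exists_polynomial_stagePath s h y₀
    (field a b N β γ ∘ Y) (Matrix.entryLinearMap ℝ ℝ i j : State n N →ₗ[ℝ] ℝ)
  rw [h1, ← sub_eq_zero]
  conv_lhs => rw [← h0]
  rw [hamiltonian_sub_eq a b N β γ hγ hs σ S hSd hS]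
  set g : ℕ → State n N := HBVM.stageCoeff (gradient a b N β γ ∘ Y) with hg
  have hJ : ∀ m, HBVM.stageCoeff (field a b N β γ ∘ Y) m = matJ n * g m := by
    intro m
    simp only [hg, HBVM.stageCoeff, Matrix.mul_sum, Function.comp_apply, field_eq,
      Matrix.mul_smul]
  -- Summing over the nodes first rebuilds `g m` from the stage gradients, leaving `⟨g m, J g m⟩`.
  have hsum : ∀ m, ∑ l, HBVM.gaussWeight (2 * s) l * ∑ i, ∑ j,
      gradient a b N β γ (Y l) i j * ((HBVM.legendre m).eval (HBVM.gaussNode (2 * s) l) *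
        (matJ n * g m) i j) = 0 := by
    intro m
    rw [← sum_mul_matJ_mul N (g m)]
    simp only [Finset.mul_sum]
    rw [Finset.sum_comm]
    refine Finset.sum_congr rfl fun i _ => ?_
    rw [Finset.sum_comm]
    refine Finset.sum_congr rfl fun j _ => ?_
    have e : g m i j = ∑ l, HBVM.gaussWeight (2 * s) l *
        (HBVM.legendre m).eval (HBVM.gaussNode (2 * s) l) * gradient a b N β γ (Y l) i j := by
      simp [hg, HBVM.stageCoeff, Matrix.sum_apply]
    rw [e, Finset.sum_mul]
    exact Finset.sum_congr rfl fun l _ => by ring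
  calc _ = h * ∑ m ∈ Finset.range s, ∑ l, HBVM.gaussWeight (2 * s) l * ∑ i, ∑ j,
        gradient a b N β γ (Y l) i j * ((HBVM.legendre m).eval (HBVM.gaussNode (2 * s) l) *
          (matJ n * g m) i j) := by
        simp only [hnode, hS', Matrix.entryLinearMap_apply, hJ, Finset.mul_sum]
        conv_rhs => rw [Finset.sum_comm]
        refine Finset.sum_congr rfl fun l _ => ?_
        conv_rhs => rw [Finset.sum_comm]
        refine Finset.sum_congr rfl fun i _ => ?_
        conv_rhs => rw [Finset.sum_comm]
        refine Finset.sum_congr rfl fun j _ => Finset.sum_congr rfl fun m _ => by ring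
    _ = 0 := by simp [hsum]

end Manakov

theorem mainTheorem2 (s : ℕ) (hs : 1 ≤ s) (n N : ℕ) (a b : ℝ) (hab : a < b)
    (β : Fin n → ℝ) (γ : Matrix (Fin n) (Fin n) ℝ) (hγ : γ.IsSymm) :
    RungeKutta.Conserves (HBVM.tableau (2 * s) s) (Manakov.field a b N β γ)
        (Manakov.hamiltonian a b N β γ) ∧
      RungeKutta.HasLocalOrder (HBVM.tableau (2 * s) s) (Manakov.field a b N β γ) (2 * s) ∧
      RungeKutta.HasGlobalOrder (HBVM.tableau (2 * s) s) (Manakov.field a b N β γ) (2 * s) :=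
  ⟨Manakov.conserves_field a b N β γ hγ hs, Manakov.hasLocalOrder_field a b N β γ hs,
    Manakov.hasGlobalOrder_field a b N β γ hs⟩
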